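/- Let $k$ be a field. All functors below are functors from $k$-modules to $k$-modules, $\mathrm{Hom}$ and $\mathrm{End}$ of functors mean natural transformations, and a decomposition is an internal direct sum decomposition, indexed by an arbitrary set. For $n\ge 1$ let $T_n(V)=V^{\otimes n}$, let $L(V)$ be the smallest Lie subalgebra of the tensor algebra $T(V)$ (with $[a,b]=ab-ba$) that contains $V$, and let $L_n(V)=L(V)\cap V^{\otimes n}$. Let $\bar V_n$ be the $k$-module with basis $x_1,\dots,x_n$, and let $d_i\colon \bar V_n\to\bar V_{n-1}$ be given by $d_i(x_j)=x_j$ for $j<i$, $d_i(x_i)=0$, $d_i(x_j)=x_{j-1}$ for $j>i$. For a functor $B$ put $$\gamma_n(B)=\bigcap_{i=1}^n\ker\bigl(B(d_i)\colon B(\bar V_n)\to B(\bar V_{n-1})\bigr),$$ a right $k\Sigma_n$-module through $x_i\cdot\sigma=x_{\sigma(i)}$ (permutations being multiplied from left to right). A natural transformation $\phi\colon B\to C$ induces a $k\Sigma_n$-linear map $\gamma_n(\phi)\colon\gamma_n(B)\to\gamma_n(C)$. Put $\mathrm{Lie}(n)=\gamma_n(L_n)$. Let $\Sigma_n$ act on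 $V^{\otimes n}$ from the left by $\sigma\cdot(a_1\cdots a_n)=a_{\sigma(1)}\cdots a_{\sigma(n)}$, and let $$\Phi_V\colon \mathrm{Lie}(n)\otimes_{k\Sigma_n}V^{\otimes n}\to L_n(V),\qquad \Bigl(\sum_{\sigma}k_\sigma x_{\sigma(1)}\cdots x_{\sigma(n)}\Bigr)\otimes a_1\cdots a_n\mapsto\sum_\sigma k_\sigma a_{\sigma(1)}\cdots a_{\sigma(n)},$$ which is natural in $V$. **Proposition.** Let $n\ge1$. 1. $\mathrm{Hom}(L_n,L_m)=0$ for every $m\ge 1$ with $m\ne n$. 2. The ring homomorphism $\gamma\colon\mathrm{End}(L_n)\to\mathrm{End}_{k\Sigma_n}(\mathrm{Lie}(n))$, $\delta\mapsto\gamma_n(\delta)$, is an isomorphism. 3. $\Phi_V$ is surjective for every $V$, and $\Phi_V\circ(\gamma_n(\delta)\otimes\mathrm{id})=\delta_V\circ\Phi_V$, naturally in $V$, for every natural transformation $\delta\colon L_n\to L_n$. 4. Consequently decompositions of the functor $L_n$ and decompositions of $\mathrm{Lie}(n)$ over $k\Sigma_n$ correspond one-to-one, with multiplicities preserved: for every index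 set $I$, the assignment $(Q_i)_{i\in I}\mapsto(\gamma_n(Q_i))_{i\in I}$ is a bijection from the families of subfunctors of $L_n$ with $L_n=\bigoplus_{i\in I} Q_i$ onto the families of $k\Sigma_n$-submodules of $\mathrm{Lie}(n)$ with direct sum $\mathrm{Lie}(n)$; for any two summands $Q,Q'$ of $L_n$ one has $Q\cong Q'$ as functors if and only if $\gamma_n(Q)\cong\gamma_n(Q')$ as $k\Sigma_n$-modules; and a summand $Q$ of $L_n$ is indecomposable if and only if $\gamma_n(Q)$ is. -/

import Mathlib

open CategoryTheory TensorProduct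

universe u w

noncomputable section

namespace LiePower

variable {k : Type u} [Field k]

/-! ### Subfunctors of functors from modules to modules -/

/-- A subfunctor of a functor `F` from `k`-modules to `k`-modules: a submodule of `F V` for every
`V`, preserved by all the maps `F f`. -/
@[ext]
structure SubFunctor (F : ModuleCat.{u} k ⥤ ModuleCat.{u} k) where
  /-- The value of the subfunctor. -/
  obj : ∀ V : ModuleCat.{u} k, Submodule k (F.obj V)
  map_mem : ∀ {V W : ModuleCat.{u} k} (f : V ⟶ W) (x : F.obj V),
    x ∈ obj V → (F.map f).hom x ∈ obj W

namespace SubFunctor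

variable {F : ModuleCat.{u} k ⥤ ModuleCat.{u} k}

/-- A subfunctor, as a functor in its own right. -/
def toFunctor (Q : SubFunctor F) : ModuleCat.{u} k ⥤ ModuleCat.{u} k where
  obj V := ModuleCat.of k (Q.obj V)
  map f := ModuleCat.ofHom ((F.map f).hom.restrict (Q.map_mem f))
  map_id V := by
    ext x
    simp
  map_comp f g := by
    ext x
    simp

/-- The inclusion of a subfunctor. -/
def incl (Q : SubFunctor F) : Q.toFunctor ⟶ F where
  app V := ModuleCat.ofHom (Q.obj V).subtype
  naturality _ _ _ := rfl

/-- `F` is the (internal) direct sum of the subfunctors `Q i`. -/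
def IsDecomposition {ι : Type*} [DecidableEq ι] (Q : ι → SubFunctor F) : Prop :=
  ∀ V : ModuleCat.{u} k, DirectSum.IsInternal fun i => (Q i).obj V

/-- `Q` is a summand of `F`: it has a complementary subfunctor. -/
def IsSummand (Q : SubFunctor F) : Prop :=
  ∃ Q' : SubFunctor F, ∀ V : ModuleCat.{u} k, IsCompl (Q.obj V) (Q'.obj V)

end SubFunctor

/-! ### The symmetric group modules `γ_n(B)` -/

variable (k)

/-- The module `V̄_n` with the basis `x_1, …, x_n` (the standard basis of `kⁿ`). -/
def Vbar (n : ℕ) : ModuleCat.{u} k := ModuleCat.of k (Fin n → k)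

/-- The standard basis of `V̄_n`. -/
def xbasis (n : ℕ) : Module.Basis (Fin n) k (Vbar k n) := Pi.basisFun k (Fin n)

/-- The basis vector `x_j` of `V̄_n`. -/
def xb {n : ℕ} (j : Fin n) : Vbar k n := xbasis k n j

/-- The linear map `f_a : V̄_n → V` with `f_a(x_j) = a_j`. -/
def fromBasis {n : ℕ} {V : ModuleCat.{u} k} (a : Fin n → V) : Vbar k n ⟶ V :=
  ModuleCat.ofHom ((xbasis k n).constr k a)

/-- The face map `d_i : V̄_n → V̄_{n-1}`, with `d_i(x_j) = x_j` for `j < i`, `d_i(x_i) = 0` and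
`d_i(x_j) = x_{j-1}` for `j > i`. -/
def face {n : ℕ} (i : Fin n) : Vbar k n ⟶ Vbar k (n - 1) :=
  fromBasis k fun j =>
    if h : j < i then xb k (⟨j, by omega⟩ : Fin (n - 1))
    else if h' : j = i then 0
    else xb k (⟨j - 1, by omega⟩ : Fin (n - 1))

/-- The map `V̄_n → V̄_n` with `x_j ↦ x_{σ(j)}`. -/
def permMap {n : ℕ} (σ : Equiv.Perm (Fin n)) : Vbar k n ⟶ Vbar k n :=
  fromBasis k fun j => xb k (σ j)

@[simp]
theorem fromBasis_xb {n : ℕ} {V : ModuleCat.{u} k} (a : Fin n → V) (j : Fin n) :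
    (fromBasis k a).hom (xb k j) = a j := by
  exact (xbasis k n).constr_basis k a j

theorem hom_ext_xb {n : ℕ} {V : ModuleCat.{u} k} {f g : Vbar k n ⟶ V}
    (h : ∀ j, f.hom (xb k j) = g.hom (xb k j)) : f = g := by
  apply ModuleCat.hom_ext
  exact (xbasis k n).ext h

theorem fromBasis_comp {n : ℕ} {V W : ModuleCat.{u} k} (a : Fin n → V) (f : V ⟶ W) :
    fromBasis k a ≫ f = fromBasis k fun j => f.hom (a j) := by
  apply hom_ext_xb
  intro j
  simp

theorem permMap_one {n : ℕ} : permMap k (1 : Equiv.Perm (Fin n)) = 𝟙 _ := by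
  apply hom_ext_xb
  intro j
  simp [permMap]

theorem permMap_mul {n : ℕ} (σ τ : Equiv.Perm (Fin n)) :
    permMap k (σ * τ) = permMap k τ ≫ permMap k σ := by
  apply hom_ext_xb
  intro j
  simp [permMap]

/-- A section of the face map `d_i`. -/
def coface {n : ℕ} (i : Fin n) : Vbar k (n - 1) ⟶ Vbar k n :=
  fromBasis k fun j =>
    if (j : ℕ) < i then xb k (⟨j, by omega⟩ : Fin n) else xb k (⟨j + 1, by omega⟩ : Fin n)

/-- A map out of `V̄_n` that kills `x_i` factors through `d_i`. -/
theorem face_factor {n : ℕ} {V : ModuleCat.{u} k} (i : Fin n) (f : Vbar k n ⟶ V)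
    (hf : f.hom (xb k i) = 0) : face k i ≫ coface k i ≫ f = f := by
  apply hom_ext_xb
  intro j
  rcases lt_trichotomy j i with h | h | h
  · have h2 : (j : ℕ) < i := h
    simp [face, coface, h, h2]
  · subst h
    simp [face, hf]
  · have h1 : ¬ j < i := not_lt_of_gt h
    have h2 : ¬ j = i := ne_of_gt h
    have h4 : (i : ℕ) < j := h
    have h3 : ¬ ((j : ℕ) - 1 < i) := by omega
    have h5 : (j : ℕ) - 1 + 1 = j := by omega
    simp [face, coface, h1, h2, h3, h5]

theorem permMap_face {n : ℕ} (σ : Equiv.Perm (Fin n)) (i : Fin n) :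
    permMap k σ ≫ face k (σ i) =
      face k i ≫ coface k i ≫ permMap k σ ≫ face k (σ i) := by
  rw [face_factor]
  simp [permMap, face]

variable (n : ℕ) (B C : ModuleCat.{u} k ⥤ ModuleCat.{u} k)

/-- `γ_n(B)`: the intersection of the kernels of the maps `B(d_i) : B(V̄_n) → B(V̄_{n-1})`,
`1 ≤ i ≤ n`. -/
def gamma : Submodule k (B.obj (Vbar k n)) :=
  ⨅ i : Fin n, LinearMap.ker (B.map (face k i)).hom

variable {n B C}

theorem mem_gamma {x : B.obj (Vbar k n)} :
    x ∈ gamma k n B ↔ ∀ i : Fin n, (B.map (face k i)).hom x = 0 := by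
  simp [gamma]

theorem perm_mem_gamma (σ : Equiv.Perm (Fin n)) (x : B.obj (Vbar k n)) (hx : x ∈ gamma k n B) :
    (B.map (permMap k σ)).hom x ∈ gamma k n B := by
  rw [mem_gamma] at hx ⊢
  intro i
  obtain ⟨j, rfl⟩ := σ.surjective i
  have h := congrArg (fun f => (B.map f).hom x) (permMap_face k σ j)
  simp only [Functor.map_comp, ModuleCat.hom_comp, LinearMap.comp_apply] at h
  rw [h, hx j]
  simp

variable (n B C)

/-- The symmetric group action on `γ_n(B)` induced by `x_i ↦ x_{σ(i)}`. Permutations are composed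
from right to left here, which makes this a left action. -/
def gammaRep : Representation k (Equiv.Perm (Fin n)) (gamma k n B) where
  toFun σ := (B.map (permMap k σ)).hom.restrict (perm_mem_gamma k σ)
  map_one' := by
    ext x
    simp [permMap_one]
  map_mul' σ τ := by
    ext x
    simp [permMap_mul]

/-- The group algebra of the symmetric group `Σ_n`. -/
abbrev SymAlg : Type u := MonoidAlgebra k (Equiv.Perm (Fin n))

/-- `γ_n(B)` as a module over the group algebra of the symmetric group. -/
abbrev Gamma : Type u := (gammaRep k n B).asModule

variable {B C}

theorem app_mem_gamma (φ : B ⟶ C) (x : B.obj (Vbar k n)) (hx : x ∈ gamma k n B) :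
    (φ.app (Vbar k n)).hom x ∈ gamma k n C := by
  rw [mem_gamma] at hx ⊢
  intro i
  have h := congrArg (fun f => f.hom x) (φ.naturality (face k i))
  simp only [ModuleCat.hom_comp, LinearMap.comp_apply] at h
  rw [← h, hx i, map_zero]

/-- `γ_n(φ) : γ_n(B) → γ_n(C)`, the map induced by `φ` at `V̄_n`. -/
def gammaMap (φ : B ⟶ C) : Gamma k n B →ₗ[SymAlg k n] Gamma k n C :=
  Representation.IntertwiningMap.equivLinearMapAsModule (gammaRep k n B) (gammaRep k n C)
    { toLinearMap := (φ.app (Vbar k n)).hom.restrict (app_mem_gamma k n φ)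
      isIntertwining' := fun σ => by
        ext x
        have h := congrArg (fun f => f.hom x.1) (φ.naturality (permMap k σ))
        exact h }

theorem gammaMap_coe (φ : B ⟶ C) (x : Gamma k n B) :
    ((gammaRep k n C).asModuleEquiv (gammaMap k n φ x)).1 =
      (φ.app (Vbar k n)).hom ((gammaRep k n B).asModuleEquiv x).1 := rfl

variable (B)

/-- The ring homomorphism `End(B) → End_{kΣ_n}(γ_n(B))`, `φ ↦ γ_n(φ)`. -/
def gammaEnd : End B →+* Module.End (SymAlg k n) (Gamma k n B) where
  toFun φ := gammaMap k n (End.asHom φ)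
  map_one' := rfl
  map_mul' _ _ := rfl
  map_zero' := rfl
  map_add' _ _ := rfl

variable {B}

/-- For a subfunctor `Q` of `B`, the module `γ_n(Q)` as a submodule of `γ_n(B)`. -/
def gammaSub (Q : SubFunctor B) : Submodule (SymAlg k n) (Gamma k n B) :=
  LinearMap.range (gammaMap k n Q.incl)

/-! ### Tensor powers and Lie powers -/

/-- The functor `T_n : V ↦ V^{⊗n}`. -/
def tensorFunctor : ModuleCat.{u} k ⥤ ModuleCat.{u} k where
  obj V := ModuleCat.of k (⨂[k]^n V)
  map f := ModuleCat.ofHom (PiTensorProduct.map fun _ => f.hom)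
  map_id V := by
    apply ModuleCat.hom_ext
    exact PiTensorProduct.map_id
  map_comp f g := by
    apply ModuleCat.hom_ext
    exact PiTensorProduct.map_comp _ _

section FreeLie

attribute [local instance] LieRing.ofAssociativeRing

/-- The free Lie algebra `L(V)`: the smallest Lie subalgebra of the tensor algebra `T(V)`, with the
bracket `[a, b] = ab - ba`, that contains `V`. -/
def freeLie (V : Type u) [AddCommGroup V] [Module k V] : LieSubalgebra k (TensorAlgebra k V) :=
  LieSubalgebra.lieSpan k (TensorAlgebra k V) (Set.range (TensorAlgebra.ι k))

/-- `L_n(V) = L(V) ∩ V^{⊗n}`, as a submodule of `V^{⊗n}`. -/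
def liePower (V : Type u) [AddCommGroup V] [Module k V] : Submodule k (⨂[k]^n V) :=
  (freeLie k V).toSubmodule.comap TensorPower.toTensorAlgebra

theorem toTensorAlgebra_map {V W : Type u} [AddCommGroup V] [Module k V] [AddCommGroup W]
    [Module k W] (f : V →ₗ[k] W) (x : ⨂[k]^n V) :
    TensorPower.toTensorAlgebra (PiTensorProduct.map (fun _ => f) x) =
      TensorAlgebra.lift k (TensorAlgebra.ι k ∘ₗ f) (TensorPower.toTensorAlgebra x) := by
  induction x using PiTensorProduct.induction_on with
  | smul_tprod r a =>
    simp [PiTensorProduct.map_tprod, TensorAlgebra.tprod_apply, map_list_prod, List.map_ofFn,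
      Function.comp_def]
  | add x y hx hy => simp [hx, hy]

theorem map_mem_liePower {V W : Type u} [AddCommGroup V] [Module k V] [AddCommGroup W]
    [Module k W] (f : V →ₗ[k] W) (x : ⨂[k]^n V) (hx : x ∈ liePower k n V) :
    PiTensorProduct.map (fun _ => f) x ∈ liePower k n W := by
  have h : freeLie k V ≤ (freeLie k W).comap
      (AlgHom.toLieHom (TensorAlgebra.lift k (TensorAlgebra.ι k ∘ₗ f))) := by
    refine LieSubalgebra.lieSpan_le.mpr ?_
    rintro _ ⟨v, rfl⟩
    have : TensorAlgebra.ι k (f v) ∈ freeLie k W := LieSubalgebra.subset_lieSpan ⟨f v, rfl⟩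
    simpa using this
  have h2 := h hx
  change TensorPower.toTensorAlgebra _ ∈ freeLie k W
  rw [toTensorAlgebra_map]
  exact h2

end FreeLie

/-- The Lie power functor, as a subfunctor of `T_n`. -/
def lieSub : SubFunctor (tensorFunctor k n) where
  obj V := liePower k n V
  map_mem f x hx := map_mem_liePower k n f.hom x hx

/-- The `n`-th Lie power functor `L_n : V ↦ L_n(V)`. -/
abbrev lieFunctor : ModuleCat.{u} k ⥤ ModuleCat.{u} k := (lieSub k n).toFunctor

/-- The symmetric group module `Lie(n) = γ_n(L_n)`. -/
abbrev Lie : Type u := Gamma k n (lieFunctor k n)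

/-! ### The functor `M ⊗_{kΣ_n} V^{⊗n}` -/

/-- The permutation of positions `a_1 ⊗ ⋯ ⊗ a_n ↦ a_{σ(1)} ⊗ ⋯ ⊗ a_{σ(n)}` on `V^{⊗n}`. -/
def permPos (V : Type u) [AddCommGroup V] [Module k V] (σ : Equiv.Perm (Fin n)) :
    ⨂[k]^n V →ₗ[k] ⨂[k]^n V :=
  (PiTensorProduct.reindex k (fun _ => V) σ.symm).toLinearMap

@[simp]
theorem permPos_tprod {V : Type u} [AddCommGroup V] [Module k V] (σ : Equiv.Perm (Fin n))
    (a : Fin n → V) :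
    permPos k n V σ (PiTensorProduct.tprod k a) = PiTensorProduct.tprod k fun j => a (σ j) := by
  simp [permPos]

theorem permPos_map {V W : Type u} [AddCommGroup V] [Module k V] [AddCommGroup W] [Module k W]
    (f : V →ₗ[k] W) (σ : Equiv.Perm (Fin n)) (x : ⨂[k]^n V) :
    PiTensorProduct.map (fun _ => f) (permPos k n V σ x) =
      permPos k n W σ (PiTensorProduct.map (fun _ => f) x) := by
  induction x using PiTensorProduct.induction_on with
  | smul_tprod r a => simp [PiTensorProduct.map_tprod]
  | add x y hx hy => simp [hx, hy]

section Balanced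
variable (M : Type u) [AddCommGroup M] [Module k M] [Module (SymAlg k n) M]
  (M' : Type u) [AddCommGroup M'] [Module k M'] [Module (SymAlg k n) M']

/-- The relations `(α · σ) ⊗ a = α ⊗ (σ · a)` for `σ ∈ Σ_n`, that turn `M ⊗_k V^{⊗n}` into
`M ⊗_{kΣ_n} V^{⊗n}`. (The permutations span the group algebra over `k`.) -/
def balRel (V : Type u) [AddCommGroup V] [Module k V] : Submodule k (M ⊗[k] (⨂[k]^n V)) :=
  Submodule.span k {t | ∃ (σ : Equiv.Perm (Fin n)) (α : M) (a : ⨂[k]^n V),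
    t = (MonoidAlgebra.of k (Equiv.Perm (Fin n)) σ • α) ⊗ₜ[k] a - α ⊗ₜ[k] permPos k n V σ a}

/-- `M ⊗_{kΣ_n} V^{⊗n}`. -/
abbrev Bal (V : Type u) [AddCommGroup V] [Module k V] : Type u :=
  (M ⊗[k] (⨂[k]^n V)) ⧸ balRel k n M V

theorem balRel_le_map {V W : Type u} [AddCommGroup V] [Module k V] [AddCommGroup W] [Module k W]
    (f : V →ₗ[k] W) :
    balRel k n M V ≤ (balRel k n M W).comap
      (TensorProduct.map LinearMap.id (PiTensorProduct.map fun _ => f)) := by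
  refine Submodule.span_le.mpr ?_
  rintro _ ⟨σ, α, a, rfl⟩
  refine Submodule.subset_span ⟨σ, α, PiTensorProduct.map (fun _ => f) a, ?_⟩
  simp [permPos_map]

/-- The functor `V ↦ M ⊗_{kΣ_n} V^{⊗n}`. -/
def balFunctor : ModuleCat.{u} k ⥤ ModuleCat.{u} k where
  obj V := ModuleCat.of k (Bal k n M V)
  map f := ModuleCat.ofHom (Submodule.mapQ _ _ _ (balRel_le_map k n M f.hom))
  map_id V := by
    apply ModuleCat.hom_ext
    apply Submodule.linearMap_qext
    apply TensorProduct.ext'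
    intro α a
    simp
  map_comp f g := by
    apply ModuleCat.hom_ext
    apply Submodule.linearMap_qext
    apply TensorProduct.ext'
    intro α a
    simp [PiTensorProduct.map_comp]

variable {M M'} [IsScalarTower k (SymAlg k n) M] [IsScalarTower k (SymAlg k n) M']

theorem balRel_le_left (θ : M →ₗ[SymAlg k n] M') (V : Type u) [AddCommGroup V] [Module k V] :
    balRel k n M V ≤ (balRel k n M' V).comap
      (TensorProduct.map (θ.restrictScalars k) LinearMap.id) := by
  refine Submodule.span_le.mpr ?_
  rintro _ ⟨σ, α, a, rfl⟩
  refine Submodule.subset_span ⟨σ, θ α, a, ?_⟩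
  simp [-MonoidAlgebra.of_apply]

/-- The natural transformation `θ ⊗ id` induced by a `kΣ_n`-linear map `θ`. -/
def balMap (θ : M →ₗ[SymAlg k n] M') : balFunctor k n M ⟶ balFunctor k n M' where
  app V := ModuleCat.ofHom (Submodule.mapQ _ _ _ (balRel_le_left k n θ V))
  naturality V W f := by
    apply ModuleCat.hom_ext
    apply Submodule.linearMap_qext
    apply TensorProduct.ext'
    intro α a
    rfl

end Balanced

/-! ### The natural transformation `Φ^B : γ_n(B) ⊗_{kΣ_n} V^{⊗n} → B(V)` for `B ⊆ T_n` -/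

/-- The coefficient of the monomial `x_{σ(1)} ⊗ ⋯ ⊗ x_{σ(n)}` in an element of `V̄_n^{⊗n}`. -/
def coeff (p : Fin n → Fin n) : ⨂[k]^n (Vbar k n) →ₗ[k] k :=
  (Basis.piTensorProduct fun _ : Fin n => xbasis k n).coord p

theorem xbasis_apply (j : Fin n) : xbasis k n j = xb k j := rfl

theorem coeff_monomial (p q : Fin n → Fin n) :
    coeff k n p (PiTensorProduct.tprod k fun j => xb k (q j)) = if q = p then 1 else 0 := by
  have h : (PiTensorProduct.tprod k fun j => xb k (q j)) =
      Basis.piTensorProduct (fun _ : Fin n => xbasis k n) q := by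
    simp [xbasis_apply]
  rw [h, coeff, Module.Basis.coord_apply, Module.Basis.repr_self, Finsupp.single_apply]

theorem hom_ext_monomial {W : Type*} [AddCommGroup W] [Module k W]
    {f g : ⨂[k]^n (Vbar k n) →ₗ[k] W}
    (h : ∀ q : Fin n → Fin n, f (PiTensorProduct.tprod k fun j => xb k (q j)) =
      g (PiTensorProduct.tprod k fun j => xb k (q j))) : f = g := by
  apply (Basis.piTensorProduct fun _ : Fin n => xbasis k n).ext
  intro q
  simpa [xbasis_apply] using h q

theorem coeff_perm (σ τ : Equiv.Perm (Fin n)) (x : ⨂[k]^n (Vbar k n)) :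
    coeff k n (τ * σ : Equiv.Perm (Fin n)) (PiTensorProduct.map (fun _ => (permMap k τ).hom) x) =
      coeff k n σ x := by
  suffices h : coeff k n (τ * σ : Equiv.Perm (Fin n)) ∘ₗ
      PiTensorProduct.map (fun _ => (permMap k τ).hom) = coeff k n σ from
    LinearMap.congr_fun h x
  apply hom_ext_monomial
  intro q
  rw [LinearMap.comp_apply, PiTensorProduct.map_tprod]
  have h : (fun j => (permMap k τ).hom (xb k (q j))) = fun j => xb k ((τ ∘ q) j) := by
    funext j
    simp [permMap]
  rw [h, coeff_monomial, coeff_monomial]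
  have h2 : τ ∘ q = ⇑(τ * σ) ↔ q = ⇑σ := by
    rw [Equiv.Perm.coe_mul]
    exact τ.injective.comp_left.eq_iff
  simp only [h2]

/-- Elements of `γ_n(T_n)` are combinations of the monomials `x_{σ(1)} ⊗ ⋯ ⊗ x_{σ(n)}` with `σ` a
permutation. -/
theorem coeff_eq_zero (x : ⨂[k]^n (Vbar k n)) (hx : x ∈ gamma k n (tensorFunctor k n))
    (p : Fin n → Fin n) (hp : ¬ Function.Surjective p) : coeff k n p x = 0 := by
  rw [Function.Surjective] at hp
  push Not at hp
  obtain ⟨i, hi⟩ := hp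
  have h0 := (mem_gamma k).1 hx i
  have h1 : coeff k n p ∘ₗ PiTensorProduct.map (fun _ => (coface k i).hom) ∘ₗ
      PiTensorProduct.map (fun _ => (face k i).hom) = coeff k n p := by
    apply hom_ext_monomial
    intro q
    rw [LinearMap.comp_apply, LinearMap.comp_apply, PiTensorProduct.map_tprod,
      PiTensorProduct.map_tprod]
    by_cases hq : ∃ j, q j = i
    · obtain ⟨j, hj⟩ := hq
      rw [MultilinearMap.map_coord_zero _ j (by simp [hj, face]), map_zero, coeff_monomial,
        if_neg]
      rintro rfl
      exact hi j hj
    · push Not at hq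
      congr 1
      congr 1
      funext j
      rcases lt_trichotomy (q j) i with h | h | h
      · have h2 : (q j : ℕ) < i := h
        simp [face, coface, h, h2]
      · exact absurd h (hq j)
      · have h1 : ¬ q j < i := not_lt_of_gt h
        have h4 : (i : ℕ) < q j := h
        have h3 : ¬ ((q j : ℕ) - 1 < i) := by omega
        have h5 : (q j : ℕ) - 1 + 1 = q j := by omega
        simp [face, coface, h1, hq j, h3, h5]
  have h2 := LinearMap.congr_fun h1 x
  have h3 : PiTensorProduct.map (fun _ => (face k i).hom) x = 0 := h0
  rw [LinearMap.comp_apply, LinearMap.comp_apply, h3, map_zero, map_zero] at h2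
  exact h2.symm

/-- The bilinear map `(α, a) ↦ ∑_σ k_σ a_{σ(1)} ⊗ ⋯ ⊗ a_{σ(n)}`, where `k_σ` is the coefficient of
`x_{σ(1)} ⊗ ⋯ ⊗ x_{σ(n)}` in `α`. -/
def phiTensor (V : Type u) [AddCommGroup V] [Module k V] :
    ⨂[k]^n (Vbar k n) →ₗ[k] ⨂[k]^n V →ₗ[k] ⨂[k]^n V :=
  ∑ σ : Equiv.Perm (Fin n), (coeff k n σ).smulRight (permPos k n V σ)

theorem phiTensor_apply (V : Type u) [AddCommGroup V] [Module k V] (x : ⨂[k]^n (Vbar k n))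
    (a : ⨂[k]^n V) :
    phiTensor k n V x a = ∑ σ : Equiv.Perm (Fin n), coeff k n σ x • permPos k n V σ a := by
  simp [phiTensor]

/-- On `γ_n(T_n)`, the bilinear map is `(α, a_1 ⊗ ⋯ ⊗ a_n) ↦ T_n(f_a)(α)`. -/
theorem phiTensor_tprod (V : ModuleCat.{u} k) (x : ⨂[k]^n (Vbar k n))
    (hx : x ∈ gamma k n (tensorFunctor k n)) (a : Fin n → V) :
    phiTensor k n V x (PiTensorProduct.tprod k a) =
      ((tensorFunctor k n).map (fromBasis k a)).hom x := by
  have h : PiTensorProduct.map (fun _ => (fromBasis k a).hom) =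
      ∑ p : Fin n → Fin n, (coeff k n p).smulRight (PiTensorProduct.tprod k fun j => a (p j)) := by
    apply hom_ext_monomial
    intro q
    simp [PiTensorProduct.map_tprod, coeff_monomial]
  have h2 : ((tensorFunctor k n).map (fromBasis k a)).hom x =
      ∑ p : Fin n → Fin n, coeff k n p x • PiTensorProduct.tprod k fun j => a (p j) := by
    exact (LinearMap.congr_fun h x).trans (by simp)
  rw [h2, phiTensor_apply]
  refine Fintype.sum_of_injective (fun σ : Equiv.Perm (Fin n) => ⇑σ) DFunLike.coe_injective _ _
    ?_ ?_
  · intro p hp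
    rw [coeff_eq_zero k n x hx p, zero_smul]
    intro hs
    exact hp ⟨Equiv.ofBijective p ⟨Finite.injective_iff_surjective.2 hs, hs⟩, rfl⟩
  · intro σ
    simp

theorem phiTensor_perm (V : Type u) [AddCommGroup V] [Module k V] (x : ⨂[k]^n (Vbar k n))
    (τ : Equiv.Perm (Fin n)) (a : ⨂[k]^n V) :
    phiTensor k n V (PiTensorProduct.map (fun _ => (permMap k τ).hom) x) a =
      phiTensor k n V x (permPos k n V τ a) := by
  rw [phiTensor_apply, phiTensor_apply, ← Equiv.sum_comp (Equiv.mulLeft τ)]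
  refine Finset.sum_congr rfl fun σ _ => ?_
  rw [Equiv.coe_mulLeft, coeff_perm]
  congr 1
  induction a using PiTensorProduct.induction_on with
  | smul_tprod r b => simp
  | add b c hb hc => simp [hb, hc]

variable {n}
variable (B : SubFunctor (tensorFunctor k n))

theorem mem_gamma_tensor (x : Gamma k n B.toFunctor) :
    ((gammaRep k n B.toFunctor).asModuleEquiv x).1.1 ∈ gamma k n (tensorFunctor k n) :=
  app_mem_gamma k n B.incl _ ((gammaRep k n B.toFunctor).asModuleEquiv x).2

/-- The inclusion `γ_n(B) ⊆ V̄_n^{⊗n}`. -/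
def gammaIncl : Gamma k n B.toFunctor →ₗ[k] ⨂[k]^n (Vbar k n) :=
  (B.obj (Vbar k n)).subtype ∘ₗ (gamma k n B.toFunctor).subtype ∘ₗ
    (gammaRep k n B.toFunctor).asModuleEquiv.toLinearMap

theorem phiTensor_mem (V : ModuleCat.{u} k) (α : Gamma k n B.toFunctor) (a : ⨂[k]^n V) :
    phiTensor k n V (gammaIncl k B α) a ∈ B.obj V := by
  induction a using PiTensorProduct.induction_on with
  | smul_tprod r a =>
    rw [map_smul]
    refine (B.obj V).smul_mem r ?_
    have h := phiTensor_tprod k n V (gammaIncl k B α) (mem_gamma_tensor k B α) a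
    have h2 := B.map_mem (fromBasis k a) _ ((gammaRep k n B.toFunctor).asModuleEquiv α).1.2
    exact (congrArg (· ∈ B.obj V) h).mpr h2
  | add x y hx hy =>
    rw [map_add]
    exact (B.obj V).add_mem hx hy

/-- `Φ^B` on `γ_n(B) ⊗_k V^{⊗n}`. -/
def phiLift (V : ModuleCat.{u} k) : Gamma k n B.toFunctor ⊗[k] (⨂[k]^n V) →ₗ[k] B.obj V :=
  LinearMap.codRestrict (B.obj V) (TensorProduct.lift (phiTensor k n V ∘ₗ gammaIncl k B)) <| by
    intro t
    induction t using TensorProduct.induction_on with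
    | zero => exact (B.obj V).zero_mem
    | tmul α a => exact phiTensor_mem k B V α a
    | add x y hx hy =>
      rw [map_add]
      exact (B.obj V).add_mem hx hy

theorem phiLift_tmul (V : ModuleCat.{u} k) (α : Gamma k n B.toFunctor) (a : ⨂[k]^n V) :
    (phiLift k B V (α ⊗ₜ[k] a)).1 = phiTensor k n V (gammaIncl k B α) a := rfl

theorem balRel_le_ker (V : ModuleCat.{u} k) :
    balRel k n (Gamma k n B.toFunctor) V ≤ LinearMap.ker (phiLift k B V) := by
  refine Submodule.span_le.mpr ?_
  rintro _ ⟨σ, α, a, rfl⟩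
  rw [SetLike.mem_coe, LinearMap.mem_ker, map_sub, sub_eq_zero]
  apply Subtype.ext
  rw [phiLift_tmul, phiLift_tmul, ← phiTensor_perm]
  congr 2
  have h : (gammaRep k n B.toFunctor).asModuleEquiv
      (MonoidAlgebra.of k (Equiv.Perm (Fin n)) σ • α) =
      gammaRep k n B.toFunctor σ ((gammaRep k n B.toFunctor).asModuleEquiv α) := by
    rw [Representation.asModuleEquiv_map_smul, Representation.asAlgebraHom_of]
  exact congrArg (fun z => z.1.1) h

/-- The natural transformation `Φ^B_V : γ_n(B) ⊗_{kΣ_n} V^{⊗n} → B(V)`, for a subfunctor `B` of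
`T_n`: it sends `α ⊗ a_1 ⋯ a_n`, where `α = ∑_σ k_σ x_{σ(1)} ⋯ x_{σ(n)}`, to
`∑_σ k_σ a_{σ(1)} ⋯ a_{σ(n)}`. -/
def Phi : balFunctor k n (Gamma k n B.toFunctor) ⟶ B.toFunctor where
  app V := ModuleCat.ofHom (Submodule.liftQ _ (phiLift k B V) (balRel_le_ker k B V))
  naturality V W f := by
    apply ModuleCat.hom_ext
    apply Submodule.linearMap_qext
    apply TensorProduct.ext'
    intro α a
    apply Subtype.ext
    change phiTensor k n W (gammaIncl k B α) (PiTensorProduct.map (fun _ => f.hom) a) =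
      PiTensorProduct.map (fun _ => f.hom) (phiTensor k n V (gammaIncl k B α) a)
    rw [phiTensor_apply, phiTensor_apply, map_sum]
    refine Finset.sum_congr rfl fun σ _ => ?_
    rw [map_smul, permPos_map]

end LiePower

end

/-! Two facts about $L_n$ carry everything: it is generated by $\gamma_n(L_n)$, and it embeds into
$T_n$.

Generation (`isGenerated_lieFunctor`): left-normed brackets span $L_n(V)$, and each is the image
under some $f_a$ of the generic bracket of $x_1,\dots,x_n$, which lies in $\gamma_n$ because a
bracket with a zero entry vanishes. A natural transformation out of $L_n$ is therefore determined by
its effect on $\gamma_n$, and $\Phi$ is surjective.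

Embedding: $\gamma_n(T_n)$ is the regular module, its endomorphisms come from permuting positions,
and it is injective in every characteristic. So an equivariant map $\gamma_n(B)\to\gamma_n(C)$
between subfunctors of $T_n$, followed by the inclusion, extends to an endomorphism of $T_n$
(`exists_gammaMap_comp_eq`). If $\gamma_n(B)$ generates $B$, this endomorphism carries $B$ into $C$,
because it does so on generators (`IsGenerated.exists_factor`). This makes $\gamma$ bijective.

Summands inherit both properties, so isomorphisms and idempotents can be compared on either side;
projections onto the pieces of a decomposition lift and descend.

For $m\ne n$, a map $L_n\to L_m$ sends $\alpha\in\gamma_n(L_n)$ to some $y\in T_m(\bar V_n)$ for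
which $T_m(f_a)(y)$ is multilinear in the $n$ vectors $a_i$, while $T_m$ has degree $m$. Hence $y=0$
(`eq_zero_of_multilinear`). -/

noncomputable section

namespace LiePower

variable {k : Type u} [Field k]

/-! ### Subfunctors generated by submodules of `γ_n(B)` -/

section Generated

variable {n : ℕ} {B C : ModuleCat.{u} k ⥤ ModuleCat.{u} k}

/-- The inclusion `γ_n(B) ⊆ B(V̄_n)`. -/
def Gamma.val : Gamma k n B →ₗ[k] B.obj (Vbar k n) :=
  (gamma k n B).subtype ∘ₗ (gammaRep k n B).asModuleEquiv.toLinearMap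

theorem Gamma.val_injective : Function.Injective (Gamma.val : Gamma k n B →ₗ[k] _) :=
  Subtype.val_injective.comp (gammaRep k n B).asModuleEquiv.injective

theorem Gamma.val_mem (z : Gamma k n B) : z.val ∈ gamma k n B :=
  ((gammaRep k n B).asModuleEquiv z).2

theorem Gamma.exists_val_eq {x : B.obj (Vbar k n)} (hx : x ∈ gamma k n B) :
    ∃ z : Gamma k n B, z.val = x :=
  ⟨(gammaRep k n B).asModuleEquiv.symm ⟨x, hx⟩, by simp [Gamma.val]⟩

theorem Gamma.val_of_smul (σ : Equiv.Perm (Fin n)) (z : Gamma k n B) :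
    (MonoidAlgebra.of k (Equiv.Perm (Fin n)) σ • z).val = (B.map (permMap k σ)).hom z.val := by
  have h : (gammaRep k n B).asModuleEquiv (MonoidAlgebra.of k (Equiv.Perm (Fin n)) σ • z) =
      gammaRep k n B σ ((gammaRep k n B).asModuleEquiv z) := by
    rw [Representation.asModuleEquiv_map_smul, Representation.asAlgebraHom_of]
  exact congrArg Subtype.val h

@[simp]
theorem Gamma.val_gammaMap (φ : B ⟶ C) (z : Gamma k n B) :
    (gammaMap k n φ z).val = (φ.app (Vbar k n)).hom z.val := rfl

theorem hom_naturality (φ : B ⟶ C) {V W : ModuleCat.{u} k} (f : V ⟶ W) (x : B.obj V) :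
    (φ.app W).hom ((B.map f).hom x) = (C.map f).hom ((φ.app V).hom x) :=
  congrArg (fun g => g.hom x) (φ.naturality f)

/-- The subfunctor of `B` generated by a submodule of `γ_n(B)`. -/
def generate (M : Submodule (SymAlg k n) (Gamma k n B)) : SubFunctor B where
  obj V := Submodule.span k {y | ∃ z ∈ M, ∃ a : Fin n → V, (B.map (fromBasis k a)).hom z.val = y}
  map_mem {V W} f x hx := by
    induction hx using Submodule.span_induction with
    | mem x hx =>
      obtain ⟨z, hz, a, rfl⟩ := hx
      refine Submodule.subset_span ⟨z, hz, fun j => f.hom (a j), ?_⟩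
      rw [← fromBasis_comp, B.map_comp]
      rfl
    | zero => simp
    | add x y _ _ hx hy => rw [map_add]; exact add_mem hx hy
    | smul r x _ hx => rw [map_smul]; exact Submodule.smul_mem _ r hx

theorem map_val_mem_generate {M : Submodule (SymAlg k n) (Gamma k n B)} {z : Gamma k n B}
    (hz : z ∈ M) {V : ModuleCat.{u} k} (a : Fin n → V) :
    (B.map (fromBasis k a)).hom z.val ∈ (generate M).obj V :=
  Submodule.subset_span ⟨z, hz, a, rfl⟩

theorem fromBasis_xb_eq_id : fromBasis k (fun j : Fin n => xb k j) = 𝟙 (Vbar k n) :=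
  hom_ext_xb k fun j => by simp

theorem val_mem_generate {M : Submodule (SymAlg k n) (Gamma k n B)} {z : Gamma k n B}
    (hz : z ∈ M) : z.val ∈ (generate M).obj (Vbar k n) := by
  have h := map_val_mem_generate hz (fun j : Fin n => xb k j)
  rw [fromBasis_xb_eq_id, B.map_id] at h
  exact h

theorem generate_le_iff {M : Submodule (SymAlg k n) (Gamma k n B)} {V : ModuleCat.{u} k}
    {S : Submodule k (B.obj V)} :
    (generate M).obj V ≤ S ↔ ∀ z ∈ M, ∀ a : Fin n → V, (B.map (fromBasis k a)).hom z.val ∈ S := by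
  refine Submodule.span_le.trans ⟨fun h z hz a => h ⟨z, hz, a, rfl⟩, ?_⟩
  rintro h _ ⟨z, hz, a, rfl⟩
  exact h z hz a

theorem generate_mono {M N : Submodule (SymAlg k n) (Gamma k n B)} (h : M ≤ N)
    (V : ModuleCat.{u} k) : (generate M).obj V ≤ (generate N).obj V :=
  generate_le_iff.2 fun _ hz a => map_val_mem_generate (h hz) a

theorem map_generate (φ : B ⟶ C) (M : Submodule (SymAlg k n) (Gamma k n B))
    (V : ModuleCat.{u} k) :
    ((generate M).obj V).map (φ.app V).hom = (generate (M.map (gammaMap k n φ))).obj V := by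
  apply le_antisymm
  · rw [Submodule.map_le_iff_le_comap, generate_le_iff]
    intro z hz a
    rw [Submodule.mem_comap, hom_naturality]
    exact map_val_mem_generate (Submodule.mem_map_of_mem hz) a
  · rw [generate_le_iff]
    rintro _ ⟨z, hz, rfl⟩ a
    refine ⟨_, map_val_mem_generate hz a, ?_⟩
    rw [hom_naturality]
    rfl

/-- Each $B(f_a)$ is additive in the generator. This inequality makes the subfunctors generated by
the pieces of a decomposition of $\gamma_n(B)$ span $B$. -/
theorem generate_iSup_le {ι : Sort*} (M : ι → Submodule (SymAlg k n) (Gamma k n B))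
    (V : ModuleCat.{u} k) : (generate (⨆ i, M i)).obj V ≤ ⨆ i, (generate (M i)).obj V := by
  rw [generate_le_iff]
  intro z hz a
  induction hz using Submodule.iSup_induction' with
  | mem i z hz => exact Submodule.mem_iSup_of_mem i (map_val_mem_generate hz a)
  | zero => simp
  | add x y _ _ hx hy => rw [map_add, map_add]; exact add_mem hx hy

/-! ### Functors generated by $\gamma_n$: faithfulness of $\gamma_n$ -/

variable (n B) in
/-- The functor `B` is generated by `γ_n(B)`. -/
def IsGenerated : Prop :=
  ∀ V : ModuleCat.{u} k, (generate (⊤ : Submodule (SymAlg k n) (Gamma k n B))).obj V = ⊤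

theorem IsGenerated.of_surjective (hB : IsGenerated n B) (φ : B ⟶ C)
    (hφ : ∀ V, Function.Surjective (φ.app V).hom) : IsGenerated n C := by
  intro V
  rw [eq_top_iff, ← LinearMap.range_eq_top.2 (hφ V), LinearMap.range_eq_map, ← hB V, map_generate]
  exact generate_mono le_top V

/-- By naturality the locus where $\phi$ and $\psi$ agree is closed under all $B(f_a)$. Allowing a
proper $M$ lets one compare a lifted projection with the identity on one piece and with zero on the
others. -/
theorem app_eq_of_mem_generate {M : Submodule (SymAlg k n) (Gamma k n B)} {φ ψ : B ⟶ C}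
    (h : ∀ z ∈ M, gammaMap k n φ z = gammaMap k n ψ z) {V : ModuleCat.{u} k} {y : B.obj V}
    (hy : y ∈ (generate M).obj V) : (φ.app V).hom y = (ψ.app V).hom y := by
  have h2 : (generate M).obj V ≤ LinearMap.eqLocus (φ.app V).hom (ψ.app V).hom := by
    rw [generate_le_iff]
    intro z hz a
    rw [LinearMap.mem_eqLocus, hom_naturality, hom_naturality, ← Gamma.val_gammaMap,
      ← Gamma.val_gammaMap, h z hz]
  exact h2 hy

theorem IsGenerated.hom_ext (hB : IsGenerated n B) {φ ψ : B ⟶ C}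
    (h : gammaMap k n φ = gammaMap k n ψ) : φ = ψ := by
  ext V y
  exact app_eq_of_mem_generate (M := ⊤) (fun z _ => by rw [h]) (hB V ▸ Submodule.mem_top)

end Generated

/-! ### Left-normed brackets -/

section Bracket

attribute [local instance] LieRing.ofAssociativeRing

variable {V W : Type u} [AddCommGroup V] [Module k V] [AddCommGroup W] [Module k W]

variable (k) in
/-- The left-normed bracket `[…[[a_0, a_1], a_2], …, a_n]` in the tensor algebra. -/
def leftBracket : (n : ℕ) → (Fin (n + 1) → V) → TensorAlgebra k V
  | 0, a => TensorAlgebra.ι k (a 0)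
  | n + 1, a => ⁅leftBracket n (Fin.init a), TensorAlgebra.ι k (a (Fin.last _))⁆

theorem leftBracket_mem_freeLie (n : ℕ) (a : Fin (n + 1) → V) :
    leftBracket k n a ∈ freeLie k V := by
  induction n with
  | zero => exact LieSubalgebra.subset_lieSpan ⟨_, rfl⟩
  | succ n ih =>
    exact LieSubalgebra.lie_mem _ (ih _) (LieSubalgebra.subset_lieSpan ⟨_, rfl⟩)

theorem lift_leftBracket (f : V →ₗ[k] W) (n : ℕ) (a : Fin (n + 1) → V) :
    TensorAlgebra.lift k (TensorAlgebra.ι k ∘ₗ f) (leftBracket k n a) =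
      leftBracket k n (fun j => f (a j)) := by
  induction n with
  | zero => simp [leftBracket]
  | succ n ih =>
    simp only [leftBracket, LieRing.of_associative_ring_bracket, map_sub, map_mul, ih]
    simp [Fin.init_def]

theorem leftBracket_eq_zero (n : ℕ) (a : Fin (n + 1) → V) (i : Fin (n + 1)) (hi : a i = 0) :
    leftBracket k n a = 0 := by
  induction n with
  | zero =>
    obtain rfl : i = 0 := Subsingleton.elim (α := Fin 1) _ _
    simp [leftBracket, hi]
  | succ n ih =>
    induction i using Fin.lastCases with
    | last => simp [leftBracket, hi]
    | cast i => rw [leftBracket, ih (Fin.init a) i hi, zero_lie]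

/-- The free index `l` absorbs the cast between degrees $1+(n+1)$ and $n+1+1$ when the two terms of
a commutator are subtracted. -/
theorem exists_toTensorAlgebra_mul {n m l : ℕ} (h : n + m = l) (x : ⨂[k]^n V) (y : ⨂[k]^m V) :
    ∃ z : ⨂[k]^l V, TensorPower.toTensorAlgebra z =
      TensorPower.toTensorAlgebra x * TensorPower.toTensorAlgebra y := by
  subst h
  exact ⟨_, TensorPower.toTensorAlgebra_gMul x y⟩

theorem exists_toTensorAlgebra_eq_leftBracket (n : ℕ) (a : Fin (n + 1) → V) :
    ∃ z : ⨂[k]^(n + 1) V, TensorPower.toTensorAlgebra z = leftBracket k n a := by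
  induction n with
  | zero => exact ⟨PiTensorProduct.tprod k a, by simp [leftBracket, TensorAlgebra.tprod_apply]⟩
  | succ n ih =>
    obtain ⟨x, hx⟩ := ih (Fin.init a)
    have hy : TensorPower.toTensorAlgebra
        (PiTensorProduct.tprod k fun _ : Fin 1 => a (Fin.last (n + 1))) =
        TensorAlgebra.ι k (a (Fin.last (n + 1))) := by
      simp [TensorAlgebra.tprod_apply]
    obtain ⟨z, hz⟩ := exists_toTensorAlgebra_mul (l := n + 1 + 1) rfl x
      (PiTensorProduct.tprod k fun _ : Fin 1 => a (Fin.last (n + 1)))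
    obtain ⟨z', hz'⟩ := exists_toTensorAlgebra_mul (l := n + 1 + 1) (by omega)
      (PiTensorProduct.tprod k fun _ : Fin 1 => a (Fin.last (n + 1))) x
    refine ⟨z - z', ?_⟩
    rw [map_sub, hz, hz', hx, hy, leftBracket, LieRing.of_associative_ring_bracket]

/-! ### Brackets as homogeneous tensors -/

theorem toDirectSum_toTensorAlgebra {n : ℕ} (x : ⨂[k]^n V) :
    TensorAlgebra.toDirectSum (TensorPower.toTensorAlgebra x) =
      DirectSum.of (fun m => ⨂[k]^m V) n x := by
  induction x using PiTensorProduct.induction_on with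
  | smul_tprod r a =>
    rw [map_smul, map_smul, TensorPower.toTensorAlgebra_tprod,
      TensorAlgebra.toDirectSum_tensorPower_tprod, DirectSum.of_smul]
  | add x y hx hy => rw [map_add, map_add, hx, hy, map_add]

theorem toTensorAlgebra_injective {n : ℕ} :
    Function.Injective (TensorPower.toTensorAlgebra : ⨂[k]^n V →ₗ[k] TensorAlgebra k V) := by
  intro x y h
  apply DirectSum.of_injective (β := fun m => ⨂[k]^m V) n
  rw [← toDirectSum_toTensorAlgebra, ← toDirectSum_toTensorAlgebra, h]

variable (k) in
/-- The left-normed bracket `[…[[a_0, a_1], a_2], …, a_n]` in the tensor power. -/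
def leftBracketTensor (n : ℕ) (a : Fin (n + 1) → V) : ⨂[k]^(n + 1) V :=
  (exists_toTensorAlgebra_eq_leftBracket n a).choose

theorem toTensorAlgebra_leftBracketTensor (n : ℕ) (a : Fin (n + 1) → V) :
    TensorPower.toTensorAlgebra (leftBracketTensor k n a) = leftBracket k n a :=
  (exists_toTensorAlgebra_eq_leftBracket n a).choose_spec

theorem leftBracketTensor_mem (n : ℕ) (a : Fin (n + 1) → V) :
    leftBracketTensor k n a ∈ liePower k (n + 1) V := by
  change TensorPower.toTensorAlgebra _ ∈ freeLie k V
  rw [toTensorAlgebra_leftBracketTensor]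
  exact leftBracket_mem_freeLie n a

theorem map_leftBracketTensor (f : V →ₗ[k] W) (n : ℕ) (a : Fin (n + 1) → V) :
    PiTensorProduct.map (fun _ => f) (leftBracketTensor k n a) =
      leftBracketTensor k n fun j => f (a j) := by
  apply toTensorAlgebra_injective
  rw [toTensorAlgebra_map, toTensorAlgebra_leftBracketTensor, toTensorAlgebra_leftBracketTensor,
    lift_leftBracket]

theorem leftBracketTensor_eq_zero (n : ℕ) (a : Fin (n + 1) → V) (i : Fin (n + 1))
    (hi : a i = 0) : leftBracketTensor k n a = 0 := by
  apply toTensorAlgebra_injective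
  rw [toTensorAlgebra_leftBracketTensor, map_zero, leftBracket_eq_zero n a i hi]

/-! ### Left-normed brackets span the free Lie algebra -/

variable (k V) in
/-- The span of the left-normed brackets. -/
def leftBracketSpan : Submodule k (TensorAlgebra k V) :=
  Submodule.span k {t | ∃ (n : ℕ) (a : Fin (n + 1) → V), leftBracket k n a = t}

theorem lie_ι_mem_leftBracketSpan {s : TensorAlgebra k V} (hs : s ∈ leftBracketSpan k V) (v : V) :
    ⁅s, TensorAlgebra.ι k v⁆ ∈ leftBracketSpan k V := by
  induction hs using Submodule.span_induction with
  | mem s hs =>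
    obtain ⟨n, a, rfl⟩ := hs
    refine Submodule.subset_span ⟨n + 1, Fin.snoc a v, ?_⟩
    simp [leftBracket]
  | zero => simp
  | add x y _ _ hx hy => rw [add_lie]; exact add_mem hx hy
  | smul r x _ hx => rw [smul_lie]; exact Submodule.smul_mem _ r hx

/-- The Jacobi identity $[s,[b,v]]=[[s,b],v]-[[s,v],b]$ shortens the right-hand bracket. The
induction must allow any $s$, since it is applied to $[s,v]$ as well. -/
theorem lie_leftBracket_mem_leftBracketSpan (n : ℕ) (a : Fin (n + 1) → V) {s : TensorAlgebra k V}
    (hs : s ∈ leftBracketSpan k V) : ⁅s, leftBracket k n a⁆ ∈ leftBracketSpan k V := by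
  induction n generalizing s with
  | zero => exact lie_ι_mem_leftBracketSpan hs _
  | succ n ih =>
    rw [leftBracket, leibniz_lie, ← lie_skew _ ⁅s, TensorAlgebra.ι k _⁆, ← sub_eq_add_neg]
    exact sub_mem (lie_ι_mem_leftBracketSpan (ih _ hs) _)
      (ih _ (lie_ι_mem_leftBracketSpan hs _))

theorem lie_mem_leftBracketSpan {s t : TensorAlgebra k V} (hs : s ∈ leftBracketSpan k V)
    (ht : t ∈ leftBracketSpan k V) : ⁅s, t⁆ ∈ leftBracketSpan k V := by
  induction ht using Submodule.span_induction with
  | mem t ht =>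
    obtain ⟨n, a, rfl⟩ := ht
    exact lie_leftBracket_mem_leftBracketSpan n a hs
  | zero => simp
  | add x y _ _ hx hy => rw [lie_add]; exact add_mem hx hy
  | smul r x _ hx => rw [lie_smul]; exact Submodule.smul_mem _ r hx

theorem freeLie_le_leftBracketSpan : (freeLie k V).toSubmodule ≤ leftBracketSpan k V := by
  have h : freeLie k V ≤
      { leftBracketSpan k V with lie_mem' := fun hs ht => lie_mem_leftBracketSpan hs ht } := by
    refine LieSubalgebra.lieSpan_le.2 ?_
    rintro _ ⟨v, rfl⟩
    exact Submodule.subset_span ⟨0, fun _ => v, rfl⟩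
  exact h

/-- The Lie power `L_{n+1}(V)` is spanned by the left-normed brackets. -/
theorem liePower_le_span (n : ℕ) : liePower k (n + 1) V ≤
    Submodule.span k {t | ∃ a : Fin (n + 1) → V, leftBracketTensor k n a = t} := by
  intro x hx
  -- Projection to degree $n+1$ fixes brackets of that length and kills all others, so a homogeneous
  -- element needs only brackets of its own degree.
  have hp : ∀ t ∈ leftBracketSpan k V, DirectSum.component k ℕ (fun m => ⨂[k]^m V) (n + 1)
      (TensorAlgebra.toDirectSum t) ∈
      Submodule.span k {t | ∃ a : Fin (n + 1) → V, leftBracketTensor k n a = t} := by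
    intro t ht
    induction ht using Submodule.span_induction with
    | mem t ht =>
      obtain ⟨m, a, rfl⟩ := ht
      rw [← toTensorAlgebra_leftBracketTensor, toDirectSum_toTensorAlgebra]
      by_cases h : m = n
      · subst h
        refine Submodule.subset_span ⟨a, ?_⟩
        exact (DirectSum.component.lof_self k (ι := ℕ) (M := fun m => ⨂[k]^m V) _ _).symm
      · have h2 : DirectSum.component k ℕ (fun m => ⨂[k]^m V) (n + 1)
            (DirectSum.of (fun m => ⨂[k]^m V) (m + 1) (leftBracketTensor k m a)) = 0 :=
          DirectSum.of_eq_of_ne _ _ _ (by omega)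
        rw [h2]
        exact zero_mem _
    | zero => simp
    | add x y _ _ hx hy => rw [map_add, map_add]; exact add_mem hx hy
    | smul r x _ hx => rw [map_smul, map_smul]; exact Submodule.smul_mem _ r hx
  have h := hp _ (freeLie_le_leftBracketSpan hx)
  rw [toDirectSum_toTensorAlgebra] at h
  have h2 := DirectSum.component.lof_self k (ι := ℕ) (M := fun m => ⨂[k]^m V) (n + 1) x
  exact h2 ▸ h

variable (k) in
theorem isGenerated_lieFunctor {n : ℕ} (hn : 1 ≤ n) : IsGenerated n (lieFunctor k n) := by
  obtain ⟨n, rfl⟩ : ∃ m, n = m + 1 := ⟨n - 1, by omega⟩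
  intro V
  -- The generic bracket: $d_i$ puts a zero in place of $x_i$, and $f_a$ turns it into the bracket
  -- of $a$.
  have hx : (⟨leftBracketTensor k n fun j => xb k j, leftBracketTensor_mem n _⟩ :
      (lieFunctor k (n + 1)).obj (Vbar k (n + 1))) ∈ gamma k (n + 1) (lieFunctor k (n + 1)) := by
    refine (mem_gamma k).2 fun i => Subtype.ext ?_
    refine (map_leftBracketTensor (face k i).hom n _).trans ?_
    exact leftBracketTensor_eq_zero n _ i (by simp [face])
  obtain ⟨z, hz⟩ := Gamma.exists_val_eq hx
  rw [eq_top_iff]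
  rintro ⟨y, hy⟩ -
  have h : liePower k (n + 1) V ≤ ((generate (⊤ : Submodule (SymAlg k (n + 1))
      (Gamma k (n + 1) (lieFunctor k (n + 1))))).obj V).map (liePower k (n + 1) V).subtype := by
    refine (liePower_le_span n).trans (Submodule.span_le.2 ?_)
    rintro _ ⟨a, rfl⟩
    refine ⟨_, map_val_mem_generate (Submodule.mem_top (x := z)) a, ?_⟩
    rw [hz]
    refine (map_leftBracketTensor (fromBasis k a).hom n _).trans ?_
    simp
  obtain ⟨y', hy', rfl⟩ := h hy
  exact hy'

end Bracket

end LiePower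

end
noncomputable section

namespace LiePower

variable {k : Type u} [Field k] {n : ℕ} {B C D : ModuleCat.{u} k ⥤ ModuleCat.{u} k}

/-! ### Lifting equivariant maps to natural transformations -/

theorem eq_sum_coeff_of_mem_gamma {y : ⨂[k]^n (Vbar k n)}
    (hy : y ∈ gamma k n (tensorFunctor k n)) :
    y = ∑ σ : Equiv.Perm (Fin n), coeff k n σ y • PiTensorProduct.tprod k fun j => xb k (σ j) := by
  have h := phiTensor_tprod k n (Vbar k n) y hy fun j => xb k j
  rw [fromBasis_xb_eq_id, (tensorFunctor k n).map_id, phiTensor_apply] at h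
  simp only [permPos_tprod] at h
  exact h.symm

variable (n) in
/-- The natural endomorphism of `T_n` given by an element of the group algebra. -/
def permPosSum (c : Equiv.Perm (Fin n) → k) : tensorFunctor k n ⟶ tensorFunctor k n where
  app V := ModuleCat.ofHom (∑ σ, c σ • permPos k n V σ)
  naturality V W f := by
    apply ModuleCat.hom_ext
    apply LinearMap.ext
    intro (x : ⨂[k]^n V)
    change (∑ σ, c σ • permPos k n W σ) (PiTensorProduct.map (fun _ => f.hom) x) =
      PiTensorProduct.map (fun _ => f.hom) ((∑ σ, c σ • permPos k n V σ) x)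
    rw [LinearMap.sum_apply, LinearMap.sum_apply, map_sum]
    refine Finset.sum_congr rfl fun σ _ => ?_
    rw [LinearMap.smul_apply, LinearMap.smul_apply, map_smul, permPos_map]

theorem permPosSum_app (c : Equiv.Perm (Fin n) → k) (V : ModuleCat.{u} k) (x : ⨂[k]^n V) :
    ((permPosSum n c).app V).hom x = ∑ σ, c σ • permPos k n V σ x := by
  change (∑ σ, c σ • permPos k n V σ) x = _
  simp

/-- An equivariant map into the regular module is encoded by one functional, its coefficient at the
identity. Over a field this functional extends from the subspace $\gamma_n(B)$ to all of $\bar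
V_n^{\otimes n}$. -/
theorem exists_coeff_extension (j : B ⟶ tensorFunctor k n)
    (hj : Function.Injective (j.app (Vbar k n)).hom)
    (θ : Gamma k n B →ₗ[SymAlg k n] Gamma k n (tensorFunctor k n)) :
    ∃ F : ⨂[k]^n (Vbar k n) →ₗ[k] k, ∀ z : Gamma k n B,
      F ((j.app (Vbar k n)).hom z.val) = coeff k n (1 : Equiv.Perm (Fin n)) (θ z).val := by
  let J : Gamma k n B →ₗ[k] ⨂[k]^n (Vbar k n) := (j.app (Vbar k n)).hom ∘ₗ Gamma.val
  have hJ : LinearMap.ker J = ⊥ := LinearMap.ker_eq_bot.2 (hj.comp Gamma.val_injective)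
  obtain ⟨g, hg⟩ := J.exists_leftInverse_of_injective hJ
  refine ⟨coeff k n (1 : Equiv.Perm (Fin n)) ∘ₗ Gamma.val ∘ₗ θ.restrictScalars k ∘ₗ g,
    fun z => ?_⟩
  have h : g ((j.app (Vbar k n)).hom z.val) = z := LinearMap.congr_fun hg z
  exact congrArg (fun w => coeff k n (1 : Equiv.Perm (Fin n)) (θ w).val) h

/-- The group algebra is injective as a module over itself, and its endomorphisms come from
permutations of the positions: equivariant maps from `γ_n(B)` to `γ_n(T_n)`, for `B` embedded into
`T_n`, extend to endomorphisms of `T_n`. -/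
theorem exists_gammaMap_comp_eq (j : B ⟶ tensorFunctor k n)
    (hj : Function.Injective (j.app (Vbar k n)).hom)
    (θ : Gamma k n B →ₗ[SymAlg k n] Gamma k n (tensorFunctor k n)) :
    ∃ ψ : tensorFunctor k n ⟶ tensorFunctor k n, gammaMap k n (j ≫ ψ) = θ := by
  obtain ⟨F, hF⟩ := exists_coeff_extension j hj θ
  -- Writing $x_\rho$ for $x_{\rho(1)}\cdots x_{\rho(n)}$, this sends $x_\rho$ to $\sum_\tau
  -- F(x_{\tau^{-1}})\,x_{\rho\tau}$, whose coefficient at $\sigma=\rho\tau$ is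
  -- $F(x_{\sigma^{-1}\rho})$.
  refine ⟨permPosSum n fun τ => F (PiTensorProduct.tprod k fun i => xb k (τ⁻¹ i)), ?_⟩
  apply LinearMap.ext
  intro z
  apply Gamma.val_injective
  set y : ⨂[k]^n (Vbar k n) := (j.app (Vbar k n)).hom z.val with hy
  have hyg : y ∈ gamma k n (tensorFunctor k n) := app_mem_gamma k n j _ z.val_mem
  -- By equivariance, the coefficient of $\theta(z)$ at $\sigma$ is that of $\theta(\sigma^{-1}z)$
  -- at the identity, which $F$ computes.
  have hcoeff : ∀ σ : Equiv.Perm (Fin n), coeff k n σ (θ z).val =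
      ∑ ρ : Equiv.Perm (Fin n), coeff k n ρ y *
        F (PiTensorProduct.tprod k fun i => xb k ((σ⁻¹ * ρ) i)) := by
    intro σ
    have h1 : coeff k n σ (θ z).val =
        coeff k n (1 : Equiv.Perm (Fin n))
          (θ (MonoidAlgebra.of k (Equiv.Perm (Fin n)) σ⁻¹ • z)).val := by
      rw [map_smul, Gamma.val_of_smul]
      have h := coeff_perm k n σ σ⁻¹ (θ z).val
      rw [inv_mul_cancel] at h
      exact h.symm
    rw [h1, ← hF, Gamma.val_of_smul, hom_naturality, ← hy]
    change F (PiTensorProduct.map (fun _ => (permMap k σ⁻¹).hom) y) = _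
    conv_lhs => rw [eq_sum_coeff_of_mem_gamma hyg]
    simp only [map_sum, map_smul, PiTensorProduct.map_tprod, smul_eq_mul]
    simp [permMap]
  change ((permPosSum n _).app (Vbar k n)).hom y = _
  rw [permPosSum_app, eq_sum_coeff_of_mem_gamma (θ z).val_mem]
  conv_lhs => rw [eq_sum_coeff_of_mem_gamma hyg]
  simp only [hcoeff, map_sum, map_smul, permPos_tprod, Finset.smul_sum, Finset.sum_smul]
  rw [Finset.sum_comm]
  conv_rhs => rw [Finset.sum_comm]
  refine Finset.sum_congr rfl fun ρ _ => ?_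
  refine Fintype.sum_equiv (Equiv.mulLeft ρ) _ _ fun τ => ?_
  rw [smul_smul, mul_comm]
  simp
  rfl

/-- On generators $\psi(B(f_a)z)=j(C(f_a)\theta z)$, so $\psi$ lands in the image of $j$ and can be
divided by this injection. -/
theorem IsGenerated.exists_factor (hB : IsGenerated n B) (ψ : B ⟶ D) (j : C ⟶ D)
    (hj : ∀ V, Function.Injective (j.app V).hom) (θ : Gamma k n B →ₗ[SymAlg k n] Gamma k n C)
    (h : gammaMap k n ψ = gammaMap k n j ∘ₗ θ) : ∃ φ : B ⟶ C, gammaMap k n φ = θ := by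
  have hr : ∀ (V : ModuleCat.{u} k) (y : B.obj V),
      (ψ.app V).hom y ∈ LinearMap.range (j.app V).hom := by
    intro V y
    have h2 : (generate (⊤ : Submodule (SymAlg k n) (Gamma k n B))).obj V ≤
        (LinearMap.range (j.app V).hom).comap (ψ.app V).hom := by
      rw [generate_le_iff]
      intro z _ a
      refine ⟨(C.map (fromBasis k a)).hom (θ z).val, ?_⟩
      rw [hom_naturality, hom_naturality, ← Gamma.val_gammaMap, ← Gamma.val_gammaMap, h]
      rfl
    exact h2 (hB V ▸ Submodule.mem_top)
  let f (V : ModuleCat.{u} k) : B.obj V →ₗ[k] C.obj V :=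
    (LinearEquiv.ofInjective (j.app V).hom (hj V)).symm.toLinearMap ∘ₗ
      (ψ.app V).hom.codRestrict _ (hr V)
  have hf : ∀ (V : ModuleCat.{u} k) (y : B.obj V), (j.app V).hom (f V y) = (ψ.app V).hom y := by
    intro V y
    exact congrArg Subtype.val ((LinearEquiv.ofInjective (j.app V).hom (hj V)).apply_symm_apply
      ⟨(ψ.app V).hom y, hr V y⟩)
  refine ⟨{ app := fun V => ModuleCat.ofHom (f V), naturality := fun V W g => ?_ }, ?_⟩
  · apply ModuleCat.hom_ext
    apply LinearMap.ext
    intro y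
    apply hj W
    change (j.app W).hom (f W ((B.map g).hom y)) = (j.app W).hom ((C.map g).hom (f V y))
    rw [hf, hom_naturality, hom_naturality, hf]
  · apply LinearMap.ext
    intro z
    apply Gamma.val_injective
    apply hj
    exact (hf _ _).trans (congrArg Gamma.val (LinearMap.congr_fun h z))

theorem IsGenerated.exists_gammaMap_eq (hB : IsGenerated n B) (i : B ⟶ tensorFunctor k n)
    (hi : ∀ V, Function.Injective (i.app V).hom) (j : C ⟶ tensorFunctor k n)
    (hj : ∀ V, Function.Injective (j.app V).hom)
    (θ : Gamma k n B →ₗ[SymAlg k n] Gamma k n C) : ∃ φ : B ⟶ C, gammaMap k n φ = θ := by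
  obtain ⟨ψ, hψ⟩ := exists_gammaMap_comp_eq i (hi _) (gammaMap k n j ∘ₗ θ)
  exact hB.exists_factor (i ≫ ψ) j hj θ hψ

/-! ### The natural transformation `Φ` -/

theorem Phi_app_tprod (B : SubFunctor (tensorFunctor k n)) (V : ModuleCat.{u} k)
    (α : Gamma k n B.toFunctor) (a : Fin n → V) :
    ((Phi k B).app V).hom (Submodule.Quotient.mk (α ⊗ₜ[k] PiTensorProduct.tprod k a)) =
      (B.toFunctor.map (fromBasis k a)).hom α.val :=
  Subtype.ext (phiTensor_tprod k n V (gammaIncl k B α) (mem_gamma_tensor k B α) a)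

theorem Phi_surjective {B : SubFunctor (tensorFunctor k n)} (hB : IsGenerated n B.toFunctor)
    (V : ModuleCat.{u} k) : Function.Surjective ((Phi k B).app V).hom := by
  rw [← LinearMap.range_eq_top, eq_top_iff, ← hB V, generate_le_iff]
  intro α _ a
  exact ⟨_, Phi_app_tprod B V α a⟩

theorem balMap_comp_Phi (B : SubFunctor (tensorFunctor k n)) (δ : B.toFunctor ⟶ B.toFunctor) :
    balMap k n (gammaMap k n δ) ≫ Phi k B = Phi k B ≫ δ := by
  ext V : 2
  apply ModuleCat.hom_ext
  apply Submodule.linearMap_qext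
  apply TensorProduct.ext
  apply LinearMap.ext
  intro α
  apply PiTensorProduct.ext
  apply MultilinearMap.ext
  intro a
  change ((Phi k B).app V).hom
      (Submodule.Quotient.mk (gammaMap k n δ α ⊗ₜ[k] PiTensorProduct.tprod k a)) =
    (δ.app V).hom (((Phi k B).app V).hom
      (Submodule.Quotient.mk (α ⊗ₜ[k] PiTensorProduct.tprod k a)))
  rw [Phi_app_tprod, Phi_app_tprod, hom_naturality]
  rfl

/-! ### Vanishing of natural transformations between different degrees -/

/-- An element of `T_m(V̄_n)` is determined by its images under all `T_m(f_a)`; if these depend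
multilinearly on `a`, it vanishes for `n ≠ m`. -/
theorem eq_zero_of_multilinear {m : ℕ} (hnm : n ≠ m) (y : ⨂[k]^m (Vbar k n))
    (N : MultilinearMap k (fun _ : Fin n => Vbar k m) (⨂[k]^m (Vbar k m)))
    (hN : ∀ a, N a = PiTensorProduct.map (fun _ => (fromBasis k a).hom) y) : y = 0 := by
  classical
  let b := Basis.piTensorProduct fun _ : Fin m => xbasis k n
  -- The coefficient of $x_1\otimes\cdots\otimes x_m$.
  let ℓ : ⨂[k]^m (Vbar k m) →ₗ[k] k := PiTensorProduct.lift
    ((MultilinearMap.mkPiAlgebra k (Fin m) k).compLinearMap fun j => (xbasis k m).coord j)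
  have hy : y = ∑ p : Fin m → Fin n,
      b.repr y p • PiTensorProduct.tprod k fun j => xb k (p j) := by
    conv_lhs => rw [← b.sum_repr y]
    simp [b, xbasis_apply]
  have hM : ∀ a, ℓ (N a) =
      ∑ p : Fin m → Fin n, b.repr y p * ∏ j, (xbasis k m).repr (a (p j)) j := by
    intro a
    rw [hN]
    conv_lhs => rw [hy]
    simp only [map_sum, map_smul, PiTensorProduct.map_tprod, smul_eq_mul]
    simp [ℓ]
  have hzero : ∀ q, b.repr y q = 0 := by
    intro q
    -- With $a_i=\sum_{q(j)=i}x_j$, only the monomial $p=q$ of $y$ contributes to $\ell$, so `ℓ`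
    -- reads off the coefficient at $q$. This avoids a comparison of degrees, which would fail over
    -- a finite field.
    let J (i : Fin n) : Finset (Fin m) := Finset.univ.filter fun j => q j = i
    have h1 : ℓ (N fun i => ∑ j ∈ J i, xb k j) = b.repr y q := by
      rw [hM, Finset.sum_eq_single q]
      · rw [Finset.prod_eq_one, mul_one]
        intro j _
        simp [← xbasis_apply, J, Finsupp.single_apply]
      · intro p _ hp
        obtain ⟨j, hj⟩ := Function.ne_iff.1 hp
        rw [Finset.prod_eq_zero (Finset.mem_univ j), mul_zero]
        simp [← xbasis_apply, J, Finsupp.single_apply, Ne.symm hj]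
      · simp
    -- Multilinear expansion runs over the sections $t$ of $q$. A nonzero term needs $t\circ
    -- p=\mathrm{id}$ for some $p$, making $t$ bijective and $n=m$.
    rw [← h1, N.map_sum_finset, map_sum]
    refine Finset.sum_eq_zero fun t ht => ?_
    have hqt : ∀ i, q (t i) = i := fun i => by
      simpa [J] using Fintype.mem_piFinset.1 ht i
    rw [hM]
    refine Finset.sum_eq_zero fun p _ => ?_
    suffices h : ∃ j, t (p j) ≠ j by
      obtain ⟨j, hj⟩ := h
      rw [Finset.prod_eq_zero (Finset.mem_univ j), mul_zero]
      simp [← xbasis_apply, hj]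
    by_contra! h
    have ht : Function.Bijective t :=
      ⟨Function.LeftInverse.injective hqt, fun j => ⟨p j, h j⟩⟩
    exact hnm (by simpa using Fintype.card_of_bijective ht)
  rw [hy]
  simp [hzero]

/-- The element $T_m(f_a)(y)=j\phi(B(f_a)\alpha)$ is multilinear in $a$ because
$B(f_a)\alpha=\Phi(\alpha\otimes a)$. -/
theorem hom_eq_zero_of_ne {m : ℕ} (hnm : n ≠ m) {B : SubFunctor (tensorFunctor k n)}
    (hB : IsGenerated n B.toFunctor) (j : C ⟶ tensorFunctor k m)
    (hj : ∀ V, Function.Injective (j.app V).hom) (φ : B.toFunctor ⟶ C) : φ = 0 := by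
  apply hB.hom_ext
  apply LinearMap.ext
  intro α
  apply Gamma.val_injective
  apply hj
  let y : ⨂[k]^m (Vbar k n) := (j.app _).hom ((φ.app _).hom α.val)
  let P : ⨂[k]^n (Vbar k m) →ₗ[k] B.obj (Vbar k m) :=
    phiLift k B (Vbar k m) ∘ₗ TensorProduct.mk k (Gamma k n B.toFunctor) (⨂[k]^n (Vbar k m)) α
  let G : ⨂[k]^n (Vbar k m) →ₗ[k] ⨂[k]^m (Vbar k m) := (j.app _).hom ∘ₗ (φ.app _).hom ∘ₗ P
  have hP : ∀ a : Fin n → Vbar k m, P (PiTensorProduct.tprod k a) =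
      (B.toFunctor.map (fromBasis k a)).hom α.val := fun a => Phi_app_tprod B (Vbar k m) α a
  have hG : ∀ a : Fin n → Vbar k m, G (PiTensorProduct.tprod k a) =
      PiTensorProduct.map (fun _ => (fromBasis k a).hom) y := by
    intro a
    have h : G (PiTensorProduct.tprod k a) =
        (j.app _).hom ((φ.app _).hom (P (PiTensorProduct.tprod k a))) := rfl
    rw [h, hP, hom_naturality, hom_naturality]
    rfl
  have hy : y = 0 := eq_zero_of_multilinear hnm y
    (G.compMultilinearMap (PiTensorProduct.tprod k)) hG
  exact hy.trans (map_zero (j.app (Vbar k n)).hom).symm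

end LiePower

end
/-! ### Internal direct sums and projections -/

section Internal

variable {R M ι : Type*} [Ring R] [AddCommGroup M] [Module R M] {A : ι → Submodule R M}

theorem Submodule.isCompl_iSup_ne_of_isInternal [DecidableEq ι] (h : DirectSum.IsInternal A)
    (i : ι) : IsCompl (A i) (⨆ j : {j // j ≠ i}, A j) := by
  rw [iSup_subtype' (p := fun j => j ≠ i) (f := fun j _ => A j) |>.symm]
  refine ⟨h.submodule_iSupIndep i, codisjoint_iff.2 ?_⟩
  rw [eq_top_iff, ← h.submodule_iSup_eq_top]
  refine iSup_le fun j => ?_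
  by_cases hj : j = i
  · exact hj ▸ le_sup_left
  · exact le_sup_of_le_right (le_iSup₂_of_le j hj le_rfl)

theorem Submodule.iSupIndep_of_forall_exists_projection
    (h : ∀ i, ∃ e : M →ₗ[R] M, (∀ x ∈ A i, e x = x) ∧ ∀ j ≠ i, ∀ x ∈ A j, e x = 0) :
    iSupIndep A := by
  intro i
  obtain ⟨e, he, he'⟩ := h i
  have h2 : ⨆ (j) (_ : j ≠ i), A j ≤ LinearMap.ker e := iSup₂_le fun j hj x hx => he' j hj x hx
  rw [Submodule.disjoint_def]
  intro x hx hx'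
  rw [← he x hx]
  exact h2 hx'

theorem Submodule.exists_projection_of_isInternal [DecidableEq ι] (h : DirectSum.IsInternal A)
    (i : ι) : ∃ e : M →ₗ[R] M, (∀ x, e x ∈ A i) ∧ (∀ x ∈ A i, e x = x) ∧
      ∀ j ≠ i, ∀ x ∈ A j, e x = 0 := by
  have hc := isCompl_iSup_ne_of_isInternal h i
  refine ⟨Submodule.projection _ _ hc, Submodule.projection_apply_mem hc,
    fun x hx => Submodule.projection_apply_left hc ⟨x, hx⟩, fun j hj x hx => ?_⟩
  rw [Submodule.projection_apply_eq_zero_iff]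
  exact Submodule.mem_iSup_of_mem (p := fun j : {j // j ≠ i} => A j) ⟨j, hj⟩ hx

end Internal

/-! ### Indecomposability in terms of idempotents -/

section Idempotents

open Limits

theorem CategoryTheory.indecomposable_iff_idempotents {C : Type*} [Category C] [Preadditive C]
    [HasBinaryBiproducts C] [IsIdempotentComplete C] (X : C) :
    Indecomposable X ↔ 𝟙 X ≠ 0 ∧ ∀ e : X ⟶ X, e ≫ e = e → e = 0 ∨ e = 𝟙 X := by
  constructor
  · rintro ⟨h0, h⟩
    refine ⟨fun h1 => h0 ((IsZero.iff_id_eq_zero X).2 h1), fun e he => ?_⟩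
    obtain ⟨Y, i, p, hip, hpi⟩ := IsIdempotentComplete.idempotents_split X e he
    have he2 : (𝟙 X - e) ≫ (𝟙 X - e) = 𝟙 X - e := by simp [he]
    obtain ⟨Z, i', p', hip', hpi'⟩ := IsIdempotentComplete.idempotents_split X (𝟙 X - e) he2
    -- Inserting the two splittings exhibits the factor $e(1-e)=0$.
    have h1 : i ≫ p' = 0 := by
      have : i ≫ p' = (i ≫ p) ≫ i ≫ p' ≫ i' ≫ p' := by simp [hip, hip']
      rw [this]
      simp only [Category.assoc]
      rw [reassoc_of% hpi, reassoc_of% hpi', ← Category.assoc e]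
      simp [he]
    have h2 : i' ≫ p = 0 := by
      have : i' ≫ p = (i' ≫ p') ≫ i' ≫ p ≫ i ≫ p := by simp [hip, hip']
      rw [this]
      simp only [Category.assoc]
      rw [reassoc_of% hpi, reassoc_of% hpi', ← Category.assoc _ e]
      simp [he]
    rcases h Y Z
      { hom := biprod.lift p p'
        inv := biprod.desc i i'
        hom_inv_id := by rw [biprod.lift_desc, hpi, hpi']; simp
        inv_hom_id := by ext <;> simp [hip, hip', h1, h2] } with hY | hZ
    · left
      rw [← hpi, hY.eq_zero_of_src i, comp_zero]
    · right
      rw [hZ.eq_zero_of_src i', comp_zero] at hpi'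
      exact (sub_eq_zero.1 hpi'.symm).symm
  · rintro ⟨h0, h⟩
    refine ⟨fun hX => h0 ((IsZero.iff_id_eq_zero X).1 hX), fun Y Z f => ?_⟩
    -- The projection onto $Y$: if it is zero then $Y=0$, if it is the identity then $Z=0$.
    rcases h (f.hom ≫ biprod.fst ≫ biprod.inl ≫ f.inv) (by simp) with he | he
    · left
      rw [IsZero.iff_id_eq_zero]
      have := congrArg (fun g => biprod.inl ≫ f.inv ≫ g ≫ f.hom ≫ biprod.fst) he
      simpa using this
    · right
      rw [IsZero.iff_id_eq_zero]
      have := congrArg (fun g => biprod.inr ≫ f.inv ≫ g ≫ f.hom ≫ biprod.snd) he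
      simpa using this.symm

theorem CategoryTheory.indecomposable_iff_of_bijective {C D : Type*} [Category C] [Preadditive C]
    [HasBinaryBiproducts C] [IsIdempotentComplete C] [Category D] [Preadditive D]
    [HasBinaryBiproducts D] [IsIdempotentComplete D] {X : C} {Y : D} (F : (X ⟶ X) → (Y ⟶ Y))
    (hF : Function.Bijective F) (h0 : F 0 = 0) (h1 : F (𝟙 X) = 𝟙 Y)
    (hc : ∀ a b, F (a ≫ b) = F a ≫ F b) : Indecomposable X ↔ Indecomposable Y := by
  rw [indecomposable_iff_idempotents, indecomposable_iff_idempotents, hF.2.forall, ne_eq, ne_eq,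
    ← h0, ← h1, hF.1.eq_iff]
  simp only [← hc, hF.1.eq_iff]

end Idempotents

noncomputable section

namespace LiePower

variable {k : Type u} [Field k] {n : ℕ} {B C : ModuleCat.{u} k ⥤ ModuleCat.{u} k}

/-! ### Summands -/

theorem SubFunctor.incl_injective (Q : SubFunctor B) (V : ModuleCat.{u} k) :
    Function.Injective (Q.incl.app V).hom := Subtype.val_injective

/-- The projection onto $Q(V)$ along $Q'(V)$ is natural because every $B(g)$ preserves both
complements. -/
theorem SubFunctor.exists_retraction {Q Q' : SubFunctor B}
    (h : ∀ V : ModuleCat.{u} k, IsCompl (Q.obj V) (Q'.obj V)) :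
    ∃ e : B ⟶ Q.toFunctor, (∀ V, ∀ y ∈ Q.obj V, (Q.incl.app V).hom ((e.app V).hom y) = y) ∧
      ∀ V, ∀ y ∈ Q'.obj V, (e.app V).hom y = 0 := by
  let f (V : ModuleCat.{u} k) : B.obj V →ₗ[k] Q.obj V :=
    (Q.obj V).projectionOnto (Q'.obj V) (h V)
  have hl : ∀ (V : ModuleCat.{u} k) (y : B.obj V) (hy : y ∈ Q.obj V), f V y = ⟨y, hy⟩ :=
    fun V y hy => Submodule.projectionOnto_apply_left (h V) ⟨y, hy⟩
  have hr : ∀ (V : ModuleCat.{u} k) (y : B.obj V), y ∈ Q'.obj V → f V y = 0 :=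
    fun V y hy => Submodule.projectionOnto_apply_right (h V) ⟨y, hy⟩
  refine ⟨{ app := fun V => ModuleCat.ofHom (f V), naturality := fun V W g => ?_ },
    fun V y hy => congrArg Subtype.val (hl V y hy), hr⟩
  apply ModuleCat.hom_ext
  apply LinearMap.ext
  intro y
  change f W ((B.map g).hom y) = (B.map g).hom.restrict (Q.map_mem g) (f V y)
  have hy : y ∈ Q.obj V ⊔ Q'.obj V := (h V).sup_eq_top ▸ Submodule.mem_top
  obtain ⟨q, hq, q', hq', rfl⟩ := Submodule.mem_sup.1 hy
  rw [map_add, map_add, map_add, hl V q hq, hr V q' hq', hl W _ (Q.map_mem g q hq),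
    hr W _ (Q'.map_mem g q' hq'), add_zero, add_zero]
  rfl

theorem SubFunctor.IsSummand.isGenerated (hB : IsGenerated n B) {Q : SubFunctor B}
    (hQ : Q.IsSummand) : IsGenerated n Q.toFunctor := by
  obtain ⟨Q', h⟩ := hQ
  obtain ⟨e, he, -⟩ := exists_retraction h
  refine hB.of_surjective e fun V y => ⟨(Q.incl.app V).hom y, ?_⟩
  exact Q.incl_injective V (he V _ y.2)

/-- Recovers $Q$ from $\gamma_n(Q)$; this gives injectivity of the correspondence of decompositions.
-/
theorem generate_gammaSub {Q : SubFunctor B} (hQ : IsGenerated n Q.toFunctor) :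
    generate (gammaSub k n Q) = Q := by
  ext V : 2
  rw [gammaSub, LinearMap.range_eq_map, ← map_generate, hQ V]
  exact (Submodule.map_top _).trans (Submodule.range_subtype _)

theorem mem_gammaSub {Q : SubFunctor B} {z : Gamma k n B} :
    z ∈ gammaSub k n Q ↔ z.val ∈ Q.obj (Vbar k n) := by
  constructor
  · rintro ⟨w, rfl⟩
    exact w.val.2
  · intro hz
    have hx : (⟨z.val, hz⟩ : Q.obj (Vbar k n)) ∈ gamma k n Q.toFunctor :=
      (mem_gamma k).2 fun i => Subtype.ext ((mem_gamma k).1 z.val_mem i)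
    obtain ⟨w, hw⟩ := Gamma.exists_val_eq hx
    exact ⟨w, Gamma.val_injective (congrArg (Q.incl.app (Vbar k n)).hom hw)⟩

theorem le_gammaSub_generate (M : Submodule (SymAlg k n) (Gamma k n B)) :
    M ≤ gammaSub k n (generate M) := fun _ hz => mem_gammaSub.2 (val_mem_generate hz)

/-! ### Decompositions -/

/-- The sum of a family of subfunctors. -/
def SubFunctor.iSup {ι : Type*} (Q : ι → SubFunctor B) : SubFunctor B where
  obj V := ⨆ i, (Q i).obj V
  map_mem {V W} f x hx := by
    have h : ⨆ i, (Q i).obj V ≤ (⨆ i, (Q i).obj W).comap (B.map f).hom :=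
      iSup_le fun i y hy => Submodule.mem_iSup_of_mem i ((Q i).map_mem f y hy)
    exact h hx

section Decomposition

variable {ι : Type w} [DecidableEq ι] {Q : ι → SubFunctor B}

theorem SubFunctor.IsDecomposition.isCompl (hQ : IsDecomposition Q) (i : ι)
    (V : ModuleCat.{u} k) :
    IsCompl ((Q i).obj V) ((SubFunctor.iSup fun j : {j // j ≠ i} => Q j).obj V) :=
  Submodule.isCompl_iSup_ne_of_isInternal (hQ V) i

theorem SubFunctor.IsDecomposition.isSummand (hQ : IsDecomposition Q) (i : ι) :
    (Q i).IsSummand := ⟨_, hQ.isCompl i⟩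

theorem SubFunctor.IsDecomposition.exists_projection (hQ : IsDecomposition Q) (i : ι) :
    ∃ e : B ⟶ B, (∀ V y, (e.app V).hom y ∈ (Q i).obj V) ∧
      (∀ V, ∀ y ∈ (Q i).obj V, (e.app V).hom y = y) ∧
      ∀ j ≠ i, ∀ V, ∀ y ∈ (Q j).obj V, (e.app V).hom y = 0 := by
  obtain ⟨e, he, he'⟩ := exists_retraction (hQ.isCompl i)
  refine ⟨e ≫ (Q i).incl, fun V y => ((e.app V).hom y).2, he, fun j hj V y hy => ?_⟩
  have h : (e.app V).hom y = 0 :=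
    he' V y (Submodule.mem_iSup_of_mem (p := fun j : {j // j ≠ i} => (Q j).obj V) ⟨j, hj⟩ hy)
  exact congrArg Subtype.val h

theorem SubFunctor.IsDecomposition.isInternal_gammaSub (hQ : IsDecomposition Q) :
    DirectSum.IsInternal fun i => gammaSub k n (Q i) := by
  choose e he he1 he0 using hQ.exists_projection
  rw [DirectSum.isInternal_submodule_iff_iSupIndep_and_iSup_eq_top]
  constructor
  · refine Submodule.iSupIndep_of_forall_exists_projection fun i => ⟨gammaMap k n (e i), ?_, ?_⟩
    · exact fun x hx => Gamma.val_injective (he1 i _ _ (mem_gammaSub.1 hx))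
    · exact fun j hj x hx =>
        Gamma.val_injective ((he0 i j hj _ _ (mem_gammaSub.1 hx)).trans (map_zero _).symm)
  · rw [eq_top_iff]
    rintro z -
    have hz : z.val ∈ ⨆ i, (Q i).obj (Vbar k n) :=
      (hQ (Vbar k n)).submodule_iSup_eq_top ▸ Submodule.mem_top
    obtain ⟨f, hf, hfz⟩ := (Submodule.mem_iSup_iff_exists_finsupp _ _).1 hz
    -- The components of $z$ in $B(\bar V_n)$ are its images under natural projections, hence stay
    -- in $\gamma_n$.
    have hfi : ∀ i, (gammaMap k n (e i) z).val = f i := by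
      intro i
      rw [Gamma.val_gammaMap, ← hfz, Finsupp.sum, map_sum, Finset.sum_eq_single i]
      · exact he1 i _ _ (hf i)
      · exact fun j _ hj => he0 i j hj _ _ (hf j)
      · intro hi
        rw [Finsupp.notMem_support_iff.1 hi, map_zero]
    have hsum : z = ∑ i ∈ f.support, gammaMap k n (e i) z := by
      apply Gamma.val_injective
      rw [map_sum]
      simp only [hfi]
      exact hfz.symm
    rw [hsum]
    refine sum_mem fun i _ => Submodule.mem_iSup_of_mem i (mem_gammaSub.2 ?_)
    exact he i _ _

theorem bijOn_gammaSub (hB : IsGenerated n B) (j : B ⟶ tensorFunctor k n)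
    (hj : ∀ V, Function.Injective (j.app V).hom) :
    Set.BijOn (fun (Q : ι → SubFunctor B) (i : ι) => gammaSub k n (Q i))
      {Q | SubFunctor.IsDecomposition Q}
      {M : ι → Submodule (SymAlg k n) (Gamma k n B) | DirectSum.IsInternal M} := by
  refine ⟨fun Q hQ => SubFunctor.IsDecomposition.isInternal_gammaSub hQ,
    fun Q hQ Q' hQ' h => funext fun i => ?_, fun M hM => ?_⟩
  · rw [← generate_gammaSub ((hQ.isSummand i).isGenerated hB),
      ← generate_gammaSub ((hQ'.isSummand i).isGenerated hB)]
    exact congrArg generate (congrFun h i)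
  -- The module projections onto the $M_i$ lift to endomorphisms of $B$, which separate the
  -- generated subfunctors.
  · have he : ∀ i, ∃ e : B ⟶ B, (∀ z, gammaMap k n e z ∈ M i) ∧
        (∀ V, ∀ y ∈ (generate (M i)).obj V, (e.app V).hom y = y) ∧
        ∀ j ≠ i, ∀ V, ∀ y ∈ (generate (M j)).obj V, (e.app V).hom y = 0 := by
      intro i
      obtain ⟨p, hp, hp1, hp0⟩ := Submodule.exists_projection_of_isInternal hM i
      obtain ⟨e, rfl⟩ := hB.exists_gammaMap_eq j hj j hj p
      refine ⟨e, hp, fun V y hy => ?_, fun j hj V y hy => ?_⟩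
      · exact app_eq_of_mem_generate (φ := e) (ψ := 𝟙 B) (fun z hz => hp1 z hz) hy
      · exact app_eq_of_mem_generate (φ := e) (ψ := 0)
          (fun z hz => (hp0 j hj z hz).trans rfl) hy
    choose e he he1 he0 using he
    refine ⟨fun i => generate (M i), fun V => ?_, funext fun i => le_antisymm (fun z hz => ?_)
      (le_gammaSub_generate _)⟩
    · rw [DirectSum.isInternal_submodule_iff_iSupIndep_and_iSup_eq_top]
      constructor
      · exact Submodule.iSupIndep_of_forall_exists_projection fun i =>
          ⟨((e i).app V).hom, he1 i V, fun j hj => he0 i j hj V⟩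
      · rw [eq_top_iff, ← hB V, ← hM.submodule_iSup_eq_top]
        exact generate_iSup_le M V
    -- Generating and then applying $\gamma_n$ adds nothing: the lifted projection fixes $z$, yet
    -- its values on $\gamma_n(B)$ lie in $M_i$.
    · have h : gammaMap k n (e i) z = z := Gamma.val_injective (he1 i _ _ (mem_gammaSub.1 hz))
      exact h ▸ he i z

end Decomposition

/-! ### Isomorphisms and indecomposability of summands -/

/-- `γ_n` of a subfunctor, as a module in its own right and as a submodule of `γ_n(B)`. -/
def gammaSubEquiv (Q : SubFunctor B) : Gamma k n Q.toFunctor ≃ₗ[SymAlg k n] gammaSub k n Q :=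
  LinearEquiv.ofInjective (gammaMap k n Q.incl) fun _ _ h =>
    Gamma.val_injective (Q.incl_injective _ (congrArg Gamma.val h))

theorem nonempty_iso_iff (hB : IsGenerated n B) (hC : IsGenerated n C)
    (i : B ⟶ tensorFunctor k n) (hi : ∀ V, Function.Injective (i.app V).hom)
    (j : C ⟶ tensorFunctor k n) (hj : ∀ V, Function.Injective (j.app V).hom) :
    Nonempty (B ≅ C) ↔ Nonempty (Gamma k n B ≃ₗ[SymAlg k n] Gamma k n C) := by
  constructor
  · rintro ⟨f⟩
    exact ⟨LinearEquiv.ofLinearMap (gammaMap k n f.hom) (gammaMap k n f.inv)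
      (congrArg (gammaMap k n) f.inv_hom_id) (congrArg (gammaMap k n) f.hom_inv_id)⟩
  · rintro ⟨f⟩
    obtain ⟨φ, hφ⟩ := hB.exists_gammaMap_eq i hi j hj f.toLinearMap
    obtain ⟨ψ, hψ⟩ := hC.exists_gammaMap_eq j hj i hi f.symm.toLinearMap
    have h1 : gammaMap k n (φ ≫ ψ) = gammaMap k n ψ ∘ₗ gammaMap k n φ := rfl
    have h2 : gammaMap k n (ψ ≫ φ) = gammaMap k n φ ∘ₗ gammaMap k n ψ := rfl
    rw [hφ, hψ] at h1 h2
    rw [LinearEquiv.symm_comp] at h1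
    rw [LinearEquiv.comp_symm] at h2
    exact ⟨⟨φ, ψ, hB.hom_ext h1, hC.hom_ext h2⟩⟩

theorem gammaEnd_bijective (hB : IsGenerated n B) (j : B ⟶ tensorFunctor k n)
    (hj : ∀ V, Function.Injective (j.app V).hom) : Function.Bijective (gammaEnd k n B) :=
  ⟨fun _ _ h => hB.hom_ext h, fun θ => hB.exists_gammaMap_eq j hj j hj θ⟩

theorem indecomposable_iff {Q : SubFunctor B}
    (h : Function.Bijective (gammaEnd k n Q.toFunctor)) :
    Indecomposable Q.toFunctor ↔
      Indecomposable (ModuleCat.of (SymAlg k n) (gammaSub k n Q)) := by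
  let F : (Q.toFunctor ⟶ Q.toFunctor) → (ModuleCat.of (SymAlg k n) (gammaSub k n Q) ⟶
      ModuleCat.of (SymAlg k n) (gammaSub k n Q)) := fun e =>
    ModuleCat.ofHom ((gammaSubEquiv Q).conjRingEquiv (gammaEnd k n Q.toFunctor e))
  refine CategoryTheory.indecomposable_iff_of_bijective F ?_ ?_ ?_ ?_
  · have hF := (gammaSubEquiv Q).conjRingEquiv.bijective.comp h
    refine ⟨fun a b hab => hF.1 (congrArg ModuleCat.Hom.hom hab), fun f => ?_⟩
    obtain ⟨e, he⟩ := hF.2 f.hom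
    exact ⟨e, ModuleCat.hom_ext he⟩
  · exact congrArg ModuleCat.ofHom (((gammaSubEquiv Q).conjRingEquiv.toRingHom.comp
      (gammaEnd k n Q.toFunctor)).map_zero)
  · exact congrArg ModuleCat.ofHom (((gammaSubEquiv Q).conjRingEquiv.toRingHom.comp
      (gammaEnd k n Q.toFunctor)).map_one)
  -- Multiplication in `End` is composition in the opposite order to `≫`, hence the swapped
  -- arguments.
  · exact fun a b => congrArg ModuleCat.ofHom (((gammaSubEquiv Q).conjRingEquiv.toRingHom.comp
      (gammaEnd k n Q.toFunctor)).map_mul b a)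

end LiePower

end

/-! ### The proposition for Lie powers -/

theorem proposition3p2 (k : Type u) [Field k] (n : ℕ) (hn : 1 ≤ n) :
    -- `Hom(L_n, L_m) = 0` for `m ≠ n`
    (∀ m : ℕ, 1 ≤ m → n ≠ m →
      ∀ φ : LiePower.lieFunctor k n ⟶ LiePower.lieFunctor k m, φ = 0) ∧
    -- `γ` is an isomorphism of rings
    Function.Bijective (LiePower.gammaEnd k n (LiePower.lieFunctor k n)) ∧
    -- the commutative square, with surjective vertical maps
    (∀ V : ModuleCat.{u} k,
      Function.Surjective ((LiePower.Phi k (LiePower.lieSub k n)).app V).hom) ∧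
    (∀ δ : CategoryTheory.End (LiePower.lieFunctor k n),
      LiePower.balMap k n (LiePower.gammaEnd k n (LiePower.lieFunctor k n) δ) ≫
          LiePower.Phi k (LiePower.lieSub k n) =
        LiePower.Phi k (LiePower.lieSub k n) ≫ CategoryTheory.End.asHom δ) ∧
    -- decompositions of `L_n` correspond to decompositions of `Lie(n)`
    (∀ (ι : Type w) [DecidableEq ι],
      Set.BijOn
        (fun (Q : ι → LiePower.SubFunctor (LiePower.lieFunctor k n)) (i : ι) =>
          LiePower.gammaSub k n (Q i))
        {Q | LiePower.SubFunctor.IsDecomposition Q}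
        {M : ι → Submodule (LiePower.SymAlg k n) (LiePower.Lie k n) |
          DirectSum.IsInternal M}) ∧
    -- isomorphism of summands is preserved and reflected
    (∀ Q Q' : LiePower.SubFunctor (LiePower.lieFunctor k n), Q.IsSummand → Q'.IsSummand →
      (Nonempty (Q.toFunctor ≅ Q'.toFunctor) ↔
        Nonempty (LiePower.gammaSub k n Q ≃ₗ[LiePower.SymAlg k n] LiePower.gammaSub k n Q'))) ∧
    -- so is indecomposability
    (∀ Q : LiePower.SubFunctor (LiePower.lieFunctor k n), Q.IsSummand →
      (CategoryTheory.Indecomposable Q.toFunctor ↔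
        CategoryTheory.Indecomposable
          (ModuleCat.of (LiePower.SymAlg k n) (LiePower.gammaSub k n Q)))) := by
  have hG := LiePower.isGenerated_lieFunctor k hn
  have hj := (LiePower.lieSub k n).incl_injective
  have hinj : ∀ (Q : LiePower.SubFunctor (LiePower.lieFunctor k n)) (V : ModuleCat.{u} k),
      Function.Injective ((Q.incl ≫ (LiePower.lieSub k n).incl).app V).hom :=
    fun Q V => (hj V).comp (Q.incl_injective V)
  refine ⟨fun m _ hnm φ => LiePower.hom_eq_zero_of_ne hnm hG _ (LiePower.lieSub k m).incl_injective
      φ, LiePower.gammaEnd_bijective hG _ hj, LiePower.Phi_surjective hG,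
    LiePower.balMap_comp_Phi _, fun ι _ => LiePower.bijOn_gammaSub hG _ hj,
    fun Q Q' hQ hQ' => ?_, fun Q hQ => ?_⟩
  · rw [LiePower.nonempty_iso_iff (hQ.isGenerated hG) (hQ'.isGenerated hG) _ (hinj Q) _ (hinj Q')]
    exact ⟨fun ⟨f⟩ => ⟨(LiePower.gammaSubEquiv Q).symm.trans
        (f.trans (LiePower.gammaSubEquiv Q'))⟩,
      fun ⟨f⟩ => ⟨(LiePower.gammaSubEquiv Q).trans
        (f.trans (LiePower.gammaSubEquiv Q').symm)⟩⟩
  · exact LiePower.indecomposable_iff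
      (LiePower.gammaEnd_bijective (hQ.isGenerated hG) _ (hinj Q))
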